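/- Let $X_0, X_1$ be connected finite CW complexes whose topologies are induced by complete length metrics $d_0, d_1$ (the distance of two points is the infimum of the lengths of the paths joining them). Let $\pi,\phi\colon X_1 \rightrightarrows X_0$ be a virtual endomorphism, i.e. $\pi,\phi$ are continuous and $\pi$ is a covering map of finite degree $\deg\pi$, and suppose that $\pi$ is a local isometry (so that $d_1$ is the length metric induced by the covering $\pi$). Suppose that $(\pi,\phi)$ is $\lambda$-backward-contracting for some $0<\lambda<1$, i.e. $d_0(\phi(a),\phi(b))\le \lambda\, d_1(a,b)$ for all $a,b\in X_1$, and recurrent, i.e. $\phi_*\colon \pi_1(X_1)\to\pi_1(X_0)$ is surjective. Let $$\mathcal J=\{(x_1,x_2,\ldots)\in X_1^{\mathbb N} : \pi(x_i)=\phi(x_{i+1}) \text{ for all } i\ge 1\}$$ be its limit space, with the subspace topology of the product topology, and let $f\colon\mathcal J\to\mathcal J$, $f(x_1,x_2,\ldots)=(x_2,x_3,\ldots)$, be the shift. Then: 1. $\mathcal J$ is connected and locally connected. 2. $f$ is a covering map of degree $\deg\pi$ and is positively expansive: $\mathcal J$ is metrizable, $f$ is a continuous surjection, and for every compatible metric $d$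 on $\mathcal J$ there is $e>0$ such that for all $x\ne y$ in $\mathcal J$ there is $n\ge 0$ with $d(f^n(x),f^n(y))>e$. 3. $f$ is topologically coarse expanding conformal (cxc): $\mathcal J$ is compact, connected and locally connected, $f$ is a covering map, and there is a finite cover $\mathcal U_0$ of $\mathcal J$ by connected open sets such that, with $\mathcal U_{n+1}$ defined inductively as the set of connected components of the sets $f^{-1}(U)$, $U\in\mathcal U_n$, the following hold. - [Expansion] For every compatible metric on $\mathcal J$, the supremum of the diameters of the elements of $\mathcal U_n$ tends to $0$ as $n\to\infty$. - [Degree] There is $p\in\mathbb N$ such that for all $n,k\ge 0$, all $U\in\mathcal U_n$ and all $\widetilde U\in\mathcal U_{n+k}$ with $f^k(\widetilde U)\subset U$, the fibers of $f^k\colon\widetilde U\to U$ have at most $p$ points. - [Irreducibility] For every nonempty open $W\subset\mathcal J$ there is $N$ with $f^N(W)=\mathcal J$. -/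

import Mathlib

open Set Filter Topology

/-- The metric of `X` is a length metric: the distance between two points is the infimum of the
lengths of the paths joining them. -/
def IsLengthMetric (X : Type*) [MetricSpace X] : Prop :=
  ∀ x y : X, edist x y = ⨅ γ : Path x y, eVariationOn (γ : unitInterval → X) univ

/-- Every point has a neighbourhood on which `p` preserves distances. -/
def IsLocalIsometry {X Y : Type*} [MetricSpace X] [MetricSpace Y] (p : X → Y) : Prop :=
  ∀ x : X, ∃ U ∈ 𝓝 x, ∀ a ∈ U, ∀ b ∈ U, dist (p a) (p b) = dist a b

/-- `p` is a covering map all of whose fibers have exactly `d` points. A pair of continuous maps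
`π, φ : X₁ ⇉ X₀` is a virtual endomorphism if `π` is a covering map of some finite degree. -/
def IsCoveringMapOfDegree {X Y : Type*} [TopologicalSpace X] [TopologicalSpace Y]
    (p : X → Y) (d : ℕ) : Prop :=
  IsCoveringMap p ∧ ∀ y : Y, (p ⁻¹' {y}).encard = d

/-- The virtual endomorphism `(π, φ)` is `c`-backward-contracting (a condition on `φ` alone). -/
def IsBackwardContracting {X₁ X₀ : Type*} [MetricSpace X₁] [MetricSpace X₀]
    (c : ℝ) (φ : X₁ → X₀) : Prop :=
  0 < c ∧ c < 1 ∧ ∀ a b : X₁, dist (φ a) (φ b) ≤ c * dist a b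

/-- The virtual endomorphism `(π, φ)` is recurrent (a condition on the spaces and `φ`): both spaces
are connected and `φ` is surjective on fundamental groups. -/
structure IsRecurrent {X₁ X₀ : Type*} [TopologicalSpace X₁] [TopologicalSpace X₀]
    (φ : C(X₁, X₀)) : Prop where
  connected_source : ConnectedSpace X₁
  connected_target : ConnectedSpace X₀
  surjective_map : ∀ x : X₁, Function.Surjective (FundamentalGroup.map φ x)

/-- The limit space of `π, φ : X₁ ⇉ X₀`: the one-sided infinite orbits, as a subspace of the
product space `ℕ → X₁`. -/
def LimitSpace {X₁ X₀ : Type*} (π φ : X₁ → X₀) : Type _ :=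
  {x : ℕ → X₁ // ∀ i, π (x i) = φ (x (i + 1))}

instance LimitSpace.instTopologicalSpace {X₁ X₀ : Type*} [TopologicalSpace X₁] (π φ : X₁ → X₀) :
    TopologicalSpace (LimitSpace π φ) :=
  inferInstanceAs (TopologicalSpace {x : ℕ → X₁ // ∀ i, π (x i) = φ (x (i + 1))})

/-- The map `(x₁, x₂, x₃, …) ↦ (x₂, x₃, …)` of the limit space. -/
def LimitSpace.shift {X₁ X₀ : Type*} (π φ : X₁ → X₀) : LimitSpace π φ → LimitSpace π φ :=
  fun x => ⟨fun i => x.1 (i + 1), fun i => x.2 (i + 1)⟩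

/-- The metric `m` induces the topology `t`. -/
def IsCompatibleMetric {X : Type*} [t : TopologicalSpace X] (m : MetricSpace X) : Prop :=
  m.toPseudoMetricSpace.toUniformSpace.toTopologicalSpace = t

/-- Two distinct points are at some time separated by more than a uniform constant. -/
def SeparatesOrbits {X : Type*} (m : MetricSpace X) (f : X → X) : Prop :=
  ∃ e > 0, ∀ x y : X, x ≠ y → ∃ n : ℕ, e < dist (f^[n] x) (f^[n] y)

/-- A positively expansive continuous surjection of a metrizable space. The separation condition
is required for every compatible metric; on a compact space it does not depend on the metric. -/
structure IsPositivelyExpansive {X : Type*} [TopologicalSpace X] (f : X → X) : Prop where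
  metrizable : TopologicalSpace.MetrizableSpace X
  continuous : Continuous f
  surjective : Function.Surjective f
  separates : ∀ m : MetricSpace X, IsCompatibleMetric m → SeparatesOrbits m f

/-- The connected components of the preimages `f ⁻¹(U)`, for `U` in the family `𝒰`. -/
def pullbackFamily {X : Type*} [TopologicalSpace X] (f : X → X) (𝒰 : Set (Set X)) : Set (Set X) :=
  {V | ∃ U ∈ 𝒰, ∃ x ∈ f ⁻¹' U, V = connectedComponentIn (f ⁻¹' U) x}

/-- The sequence of coverings `𝒰₀, 𝒰₁, 𝒰₂, …` generated by `𝒰₀`. -/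
def iteratedPullback {X : Type*} [TopologicalSpace X] (f : X → X) (𝒰₀ : Set (Set X)) (n : ℕ) :
    Set (Set X) :=
  (pullbackFamily f)^[n] 𝒰₀

/-- The supremum of the diameters of the members of a family of sets. -/
noncomputable def mesh {X : Type*} (m : MetricSpace X) (𝒰 : Set (Set X)) : ENNReal :=
  ⨆ U ∈ 𝒰, Metric.ediam U

/-- Axiom [Expansion]; on a compact space the condition does not depend on the metric. -/
def AxiomExpansion {X : Type*} [TopologicalSpace X] (f : X → X) (𝒰₀ : Set (Set X)) : Prop :=
  TopologicalSpace.MetrizableSpace X ∧ ∀ m : MetricSpace X, IsCompatibleMetric m →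
    Tendsto (fun n => mesh m (iteratedPullback f 𝒰₀ n)) atTop (𝓝 0)

/-- Axiom [Degree]: one bound for the cardinalities of the fibers of all the restrictions
`f^k : V → U` with `U ∈ 𝒰ₙ`, `V ∈ 𝒰ₙ₊ₖ`, where `n` and `k` are arbitrary. -/
def AxiomDegree {X : Type*} [TopologicalSpace X] (f : X → X) (𝒰₀ : Set (Set X)) : Prop :=
  ∃ p : ℕ, ∀ n k : ℕ, ∀ U ∈ iteratedPullback f 𝒰₀ n, ∀ V ∈ iteratedPullback f 𝒰₀ (n + k),
    MapsTo f^[k] V U → ∀ y ∈ U, (V ∩ f^[k] ⁻¹' {y}).encard ≤ p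

/-- Axiom [Irreducibility]. -/
def AxiomIrreducibility {X : Type*} [TopologicalSpace X] (f : X → X) : Prop :=
  ∀ W : Set X, IsOpen W → W.Nonempty → ∃ N : ℕ, f^[N] '' W = univ

/-- A self-covering of a compact, connected, locally connected space is topologically coarse
expanding conformal. -/
structure IsTopologicallyCXC {X : Type*} [TopologicalSpace X] (f : X → X) : Prop where
  compact : CompactSpace X
  connected : ConnectedSpace X
  locallyConnected : LocallyConnectedSpace X
  isCoveringMap : IsCoveringMap f
  exists_cover : ∃ 𝒰₀ : Set (Set X), 𝒰₀.Finite ∧ (∀ U ∈ 𝒰₀, IsOpen U ∧ IsConnected U) ∧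
    ⋃₀ 𝒰₀ = univ ∧ AxiomExpansion f 𝒰₀ ∧ AxiomDegree f 𝒰₀ ∧ AxiomIrreducibility f

open scoped unitInterval

/-! By compactness there is a scale `ρ` below which `π` is isometric and has isometric local
sections. Below it, passing from a term of an orbit to the preceding one, by applying `φ` and
lifting through `π`, contracts by `c`. Hence two points of the limit space whose coordinates stay
`ρ`-close for all time coincide (`eq_of_forall_dist_lt`). This yields expansiveness and the [Degree]
bound 1. Pullbacks of small sets shrink geometrically (`dist_le_of_mem_iteratedPullback`), which is
[Expansion]. The shift is an open, locally injective map of a compact Hausdorff space, hence a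
covering.

The substantial part is connectedness, where recurrence is used. Extend orbits to two-sided ones and
call two of them linked at time `n` if their pasts at `n` are joined by `N` short steps. Transport
of pasts along a path depends only on its homotopy class. If a path `q` carries one past to another,
and `a`, `b` are possible next terms, then recurrence makes `π ∘ q` homotopic to `φ ∘ ω` for a path
`ω` from `a` to `b`, and transport along `ω` joins the two extended pasts
(`IsRecurrent.exists_steps_consSeq`). By compactness the number of steps is bounded uniformly, so a
link at time `n` splits into boundedly many links at time `n + 1` (`exists_steps_linkedAt_succ`).

Under iteration the displacement of earlier terms is bounded by a geometric series, so links at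
arbitrarily late times are obtained inside one cylinder (`exists_chain_linkedAt`). Such orbits are
close in the limit space, and in a compact set points joined by arbitrarily fine chains share a
component. All pairs of points can be linked at time 0, giving connectedness; points with close
coordinates up to `n` can be linked at `n`, giving local connectedness. For [Irreducibility], a past
of `x` is moved by `N` steps to end at the first term of a given `z` and is continued by `z`. -/

/-- `x` and `y` are joined by a sequence of exactly `n` steps of the relation `R`. -/
def Steps {α : Type*} (R : α → α → Prop) (n : ℕ) (x y : α) : Prop :=
  ∃ z : ℕ → α, z 0 = x ∧ z n = y ∧ ∀ j < n, R (z j) (z (j + 1))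

/-! ### Chains -/

namespace Steps

variable {α : Type*} {R : α → α → Prop} {m n : ℕ} {x y z : α}

theorem zero (x : α) : Steps R 0 x x := ⟨fun _ => x, rfl, rfl, by simp⟩

theorem single (h : R x y) : Steps R 1 x y :=
  ⟨fun j => if j = 0 then x else y, by simp, by simp, fun j hj => by
    obtain rfl : j = 0 := by omega
    simpa using h⟩

theorem trans (h₁ : Steps R m x y) (h₂ : Steps R n y z) : Steps R (m + n) x z := by
  obtain ⟨u, hu0, hum, hu⟩ := h₁
  obtain ⟨v, hv0, hvn, hv⟩ := h₂
  refine ⟨fun j => if j ≤ m then u j else v (j - m), by simpa using hu0, ?_, fun j hj => ?_⟩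
  · rcases Nat.eq_zero_or_pos n with rfl | hn
    · simp only [Nat.add_zero, le_refl, if_true]
      rw [hum, ← hv0, hvn]
    · simp only [show ¬ m + n ≤ m by omega, if_false, Nat.add_sub_cancel_left, hvn]
  · rcases lt_trichotomy j m with h | rfl | h
    · simpa [h.le, Nat.succ_le_of_lt h] using hu j h
    · have := hv 0 (by omega)
      rw [hv0, ← hum] at this
      simpa using this
    · have := hv (j - m) (by omega)
      simpa [show ¬ j ≤ m by omega, show ¬ j + 1 ≤ m by omega,
        show j - m + 1 = j + 1 - m by omega] using this

theorem symm (hR : ∀ x y, R x y → R y x) (h : Steps R n x y) : Steps R n y x := by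
  obtain ⟨u, hu0, hun, hu⟩ := h
  refine ⟨fun j => u (n - j), by simpa using hun, by simpa using hu0, fun j hj => ?_⟩
  have := hR _ _ (hu (n - (j + 1)) (by omega))
  rwa [show n - (j + 1) + 1 = n - j by omega] at this

theorem mono (hx : R y y) (hmn : m ≤ n) (h : Steps R m x y) : Steps R n x y := by
  have : Steps R (n - m) y y := ⟨fun _ => y, rfl, rfl, fun _ _ => hx⟩
  simpa [hmn] using h.trans this

end Steps

/-! ### Local geometry: gaps in distances, and a uniform scale for the covering -/

/-- A continuous real function on a preconnected set that omits the values in `(r, ρ)`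
and is somewhere at most `r` is everywhere at most `r`. -/
theorem IsPreconnected.forall_le_of_gap {T : Type*} [TopologicalSpace T] {S : Set T}
    (hS : IsPreconnected S) {g : T → ℝ} (hg : ContinuousOn g S) {r ρ : ℝ} (hr : r < ρ)
    (hgap : ∀ t ∈ S, g t < ρ → g t ≤ r) {s : T} (hs : s ∈ S) (hgs : g s ≤ r) :
    ∀ t ∈ S, g t ≤ r := by
  intro t ht
  by_contra! hlt
  have hρ : ρ ≤ g t := by
    by_contra! h
    exact absurd (hgap t ht h) (not_le.2 hlt)
  obtain ⟨u, hu, hgu⟩ := hS.intermediate_value hs ht hg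
    (show (r + ρ) / 2 ∈ Icc (g s) (g t) from ⟨by linarith, by linarith⟩)
  have := hgap u hu (by linarith)
  linarith

/-- At scale `ρ`, the map `p` is isometric and has isometric local sections. -/
structure HasIsometricSheets {X Y : Type*} [MetricSpace X] [MetricSpace Y] (p : X → Y) (ρ : ℝ) :
    Prop where
  pos : 0 < ρ
  isometric : ∀ a b, dist a b < ρ → dist (p a) (p b) = dist a b
  exists_lift : ∀ a z, dist (p a) z < ρ → ∃ b, p b = z ∧ dist a b = dist (p a) z

/-- A Lebesgue number `δ` makes `p` isometric at scale `δ`. Openness of `p` and compactness give one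
radius within which points lift to distance less than `δ`; the isometry at that scale then makes the
lifting distance exact. -/
theorem IsLocalIsometry.exists_hasIsometricSheets {X Y : Type*} [MetricSpace X] [MetricSpace Y]
    [CompactSpace X] {p : X → Y} (hp : IsLocalIsometry p) (hc : Continuous p) (ho : IsOpenMap p) :
    ∃ ρ, HasIsometricSheets p ρ := by
  choose U hU hUd using hp
  obtain ⟨δ, hδ, hδU⟩ := lebesgue_number_lemma_of_metric (isCompact_univ (X := X))
    (fun x => isOpen_interior (s := U x))
    (fun x _ => mem_iUnion.2 ⟨x, mem_interior_iff_mem_nhds.2 (hU x)⟩)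
  have hiso : ∀ a b, dist a b < δ → dist (p a) (p b) = dist a b := by
    intro a b hab
    obtain ⟨i, hi⟩ := hδU a (mem_univ a)
    exact hUd i a (interior_subset (hi (Metric.mem_ball_self hδ))) b
      (interior_subset (hi (by rwa [Metric.mem_ball'])))
  have hopen : ∃ s > 0, ∀ a ∈ (univ : Set X), ∀ z, dist (p a) z < s → ∃ b, p b = z ∧ dist a b < δ := by
    refine isCompact_univ.induction_on
      (p := fun A => ∃ s > 0, ∀ a ∈ A, ∀ z, dist (p a) z < s → ∃ b, p b = z ∧ dist a b < δ)
      ⟨1, one_pos, by simp⟩ ?_ ?_ ?_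
    · rintro A B hAB ⟨s, hs, h⟩
      exact ⟨s, hs, fun a ha => h a (hAB ha)⟩
    · rintro A B ⟨s, hs, h⟩ ⟨t, ht, h'⟩
      refine ⟨min s t, lt_min hs ht, ?_⟩
      rintro a (ha | ha) z hz
      · exact h a ha z (hz.trans_le (min_le_left _ _))
      · exact h' a ha z (hz.trans_le (min_le_right _ _))
    · intro x _
      obtain ⟨s, hs, hsub⟩ := Metric.isOpen_iff.1 (ho _ (Metric.isOpen_ball (x := x) (ε := δ / 2)))
        (p x) (mem_image_of_mem p (Metric.mem_ball_self (half_pos hδ)))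
      refine ⟨Metric.ball x (δ / 2) ∩ p ⁻¹' Metric.ball (p x) (s / 2), ?_, s / 2, half_pos hs, ?_⟩
      · rw [nhdsWithin_univ]
        exact inter_mem (Metric.ball_mem_nhds _ (half_pos hδ))
          (hc.continuousAt.preimage_mem_nhds (Metric.ball_mem_nhds _ (half_pos hs)))
      · rintro a ⟨ha, ha'⟩ z hz
        obtain ⟨b, hb, rfl⟩ := hsub (show z ∈ Metric.ball (p x) s by
          rw [Metric.mem_ball']
          rw [mem_preimage, Metric.mem_ball'] at ha'
          linarith [dist_triangle (p x) (p a) z])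
        refine ⟨b, rfl, ?_⟩
        rw [Metric.mem_ball] at ha hb
        linarith [dist_triangle a x b, dist_comm x b]
  obtain ⟨s, hs, h⟩ := hopen
  refine ⟨min δ s, lt_min hδ hs, fun a b hab => hiso a b (hab.trans_le (min_le_left _ _)),
    fun a z hz => ?_⟩
  obtain ⟨b, rfl, hb⟩ := h a (mem_univ a) z (hz.trans_le (min_le_right _ _))
  exact ⟨b, rfl, (hiso a b hb).symm⟩

/-- A path of length less than `R` cannot leave the closed `R`-ball about its starting point. -/
theorem IsLengthMetric.exists_path {X : Type*} [MetricSpace X] (h : IsLengthMetric X) {x y : X}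
    {R : ℝ} (hR : dist x y < R) : ∃ γ : Path x y, ∀ t, dist x (γ t) ≤ R := by
  have h1 : edist x y < ENNReal.ofReal R := by
    rw [edist_dist]
    exact (ENNReal.ofReal_lt_ofReal_iff (dist_nonneg.trans_lt hR)).2 hR
  rw [h x y, iInf_lt_iff] at h1
  obtain ⟨γ, hγ⟩ := h1
  refine ⟨γ, fun t => ?_⟩
  have h2 := (eVariationOn.edist_le (γ : unitInterval → X) (mem_univ 0) (mem_univ t)).trans hγ.le
  rw [γ.source, edist_dist] at h2
  exact (ENNReal.ofReal_le_ofReal_iff (dist_nonneg.trans hR.le)).1 h2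

theorem compactSpace_of_finite_cwComplex {X : Type*} [TopologicalSpace X] [T2Space X]
    [CWComplex (univ : Set X)] [CWComplex.Finite (univ : Set X)] : CompactSpace X := by
  refine ⟨?_⟩
  rw [← CWComplex.union (C := (univ : Set X))]
  obtain ⟨n, hn⟩ := eventually_atTop.1
    (RelCWComplex.FiniteDimensional.eventually_isEmpty_cell (C := (univ : Set X)) (D := ∅))
  have hfin : ∀ m, _root_.Finite (RelCWComplex.cell (univ : Set X) m) :=
    fun m => RelCWComplex.FiniteType.finite_cell (C := (univ : Set X)) (D := ∅) m
  have : (⋃ (m : ℕ) (j : RelCWComplex.cell (univ : Set X) m), RelCWComplex.closedCell m j) =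
      ⋃ m ∈ Finset.range n, ⋃ j : RelCWComplex.cell (univ : Set X) m, RelCWComplex.closedCell m j := by
    ext x
    simp only [mem_iUnion, Finset.mem_range, exists_prop]
    refine ⟨fun ⟨m, j, hx⟩ => ⟨m, ?_, j, hx⟩, fun ⟨m, _, j, hx⟩ => ⟨m, j, hx⟩⟩
    by_contra! hm
    exact (hn m hm).false j
  rw [this]
  exact (Finset.range n).isCompact_biUnion fun m _ =>
    isCompact_iUnion fun j => CWComplex.isCompact_closedCell

/-! ### Pasts and their contraction in backward time -/

section Past

variable {X₀ X₁ : Type*}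

/-- `ξ 0, ξ 1, …` are successive lifts: each `ξ (k + 1)` is a `π`-preimage of `φ (ξ k)`. -/
def IsPast (π φ : X₁ → X₀) (ξ : ℕ → X₁) : Prop := ∀ k, π (ξ (k + 1)) = φ (ξ k)

/-- Prepend a term to a sequence. -/
def consSeq {X : Type*} (a : X) (ξ : ℕ → X) : ℕ → X
  | 0 => a
  | k + 1 => ξ k

theorem IsPast.consSeq {π φ : X₁ → X₀} {ξ : ℕ → X₁} (h : IsPast π φ ξ) {a : X₁}
    (ha : π (ξ 0) = φ a) : IsPast π φ (consSeq a ξ)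
  | 0 => ha
  | k + 1 => h k

theorem exists_isPast {π φ : X₁ → X₀} (hπ : Function.Surjective π) (a : X₁) :
    ∃ ξ, IsPast π φ ξ ∧ ξ 0 = a := by
  choose g hg using hπ
  exact ⟨fun k => (fun x => g (φ x))^[k] a, fun k => by
    simp only [Function.iterate_succ_apply', hg], rfl⟩

variable [MetricSpace X₁] {π φ : X₁ → X₀} {c ρ r : ℝ}

/-- Two pasts that stay within `r` of each other. -/
structure PastStep (π φ : X₁ → X₀) (r : ℝ) (ξ η : ℕ → X₁) : Prop where
  left : IsPast π φ ξ
  right : IsPast π φ η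
  dist_le : ∀ k, dist (ξ k) (η k) ≤ r

theorem PastStep.symm {ξ η : ℕ → X₁} (h : PastStep π φ r ξ η) : PastStep π φ r η ξ :=
  ⟨h.right, h.left, fun k => by rw [dist_comm]; exact h.dist_le k⟩

theorem IsPast.step_self {ξ : ℕ → X₁} (h : IsPast π φ ξ) (hr : 0 ≤ r) : PastStep π φ r ξ ξ :=
  ⟨h, h, fun k => by simpa using hr⟩

theorem Steps.isPast_right {n : ℕ} {ξ η : ℕ → X₁} (h : Steps (PastStep π φ r) n ξ η)
    (hξ : IsPast π φ ξ) : IsPast π φ η := by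
  obtain ⟨ζ, rfl, rfl, hζ⟩ := h
  cases n with
  | zero => exact hξ
  | succ n => exact (hζ n (by omega)).right

variable [MetricSpace X₀]

/-- While the terms are `ρ`-close, `π` preserves their distance, so each further step into the past
costs only the factor `c` of `φ`. -/
theorem IsPast.dist_le_pow (hρ : HasIsometricSheets π ρ) (hφ : IsBackwardContracting c φ)
    {ξ η : ℕ → X₁} (hξ : IsPast π φ ξ) (hη : IsPast π φ η) (h : ∀ k, dist (ξ k) (η k) < ρ) (k : ℕ) :
    dist (ξ k) (η k) ≤ c ^ k * dist (ξ 0) (η 0) := by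
  induction k with
  | zero => simp
  | succ k ih =>
    rw [← hρ.isometric _ _ (h (k + 1)), hξ k, hη k]
    calc dist (φ (ξ k)) (φ (η k)) ≤ c * dist (ξ k) (η k) := hφ.2.2 _ _
      _ ≤ c * (c ^ k * dist (ξ 0) (η 0)) := by gcongr; exact hφ.1.le
      _ = _ := by ring

theorem IsPast.dist_le (hρ : HasIsometricSheets π ρ) (hφ : IsBackwardContracting c φ)
    {ξ η : ℕ → X₁} (hξ : IsPast π φ ξ) (hη : IsPast π φ η) (h : ∀ k, dist (ξ k) (η k) < ρ) (k : ℕ) :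
    dist (ξ k) (η k) ≤ dist (ξ 0) (η 0) :=
  (hξ.dist_le_pow hρ hφ hη h k).trans
    (mul_le_of_le_one_left dist_nonneg (pow_le_one₀ hφ.1.le hφ.2.1.le))

/-- Pasts that stay close and have the same initial term agree. -/
theorem IsPast.eq_of_dist_lt (hρ : HasIsometricSheets π ρ) (hφ : IsBackwardContracting c φ)
    {ξ η : ℕ → X₁} (hξ : IsPast π φ ξ) (hη : IsPast π φ η) (h : ∀ k, dist (ξ k) (η k) < ρ)
    (h0 : ξ 0 = η 0) : ξ = η := by
  funext k
  have := hξ.dist_le hρ hφ hη h k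
  rw [h0, dist_self] at this
  exact dist_le_zero.1 this

/-- A past can be transported to any initial term close to its own. -/
theorem IsPast.exists_step (hρ : HasIsometricSheets π ρ) (hφ : IsBackwardContracting c φ)
    {ξ : ℕ → X₁} (hξ : IsPast π φ ξ) {z : X₁} (hr : r < ρ) (hz : dist (ξ 0) z ≤ r) :
    ∃ η, η 0 = z ∧ PastStep π φ r ξ η := by
  -- The bound by `r` is carried in the subtype, so that the lift at every stage is the one near `ξ`
  -- and the recursion can continue.
  have key : ∀ k, ∀ b : {b // dist (ξ k) b ≤ r}, ∃ b' : {b // dist (ξ (k + 1)) b ≤ r},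
      π b'.1 = φ b.1 := by
    rintro k ⟨b, hb⟩
    have h1 : dist (π (ξ (k + 1))) (φ b) ≤ r := by
      rw [hξ k]
      calc _ ≤ c * dist (ξ k) b := hφ.2.2 _ _
        _ ≤ 1 * dist (ξ k) b := by gcongr; exact hφ.2.1.le
        _ ≤ r := by simpa using hb
    obtain ⟨b', hb', hd⟩ := hρ.exists_lift _ _ (h1.trans_lt hr)
    exact ⟨⟨b', hd.trans_le h1⟩, hb'⟩
  choose g hg using key
  let η : (k : ℕ) → {b // dist (ξ k) b ≤ r} := fun k => Nat.rec ⟨z, hz⟩ (fun k b => g k b) k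
  exact ⟨fun k => (η k).1, rfl, hξ, fun k => hg k (η k), fun k => (η k).2⟩

theorem Steps.dist_past_le (hρ : HasIsometricSheets π ρ) (hφ : IsBackwardContracting c φ)
    (hr : r < ρ) {n : ℕ} {ξ η : ℕ → X₁} (h : Steps (PastStep π φ r) n ξ η) (k : ℕ) :
    dist (ξ k) (η k) ≤ n * r * c ^ k := by
  obtain ⟨ζ, rfl, rfl, hζ⟩ := h
  induction n with
  | zero => simp
  | succ n ih =>
    have h1 := ih fun j hj => hζ j (by omega)
    have h2 := hζ n (by omega)
    have h3 := h2.left.dist_le_pow hρ hφ h2.right (fun k => (h2.dist_le k).trans_lt hr) k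
    have h4 : c ^ k * dist (ζ n 0) (ζ (n + 1) 0) ≤ c ^ k * r :=
      mul_le_mul_of_nonneg_left (h2.dist_le 0) (pow_nonneg hφ.1.le k)
    push_cast
    linarith [dist_triangle (ζ 0 k) (ζ n k) (ζ (n + 1) k)]

/-- Chains of initial terms lift to chains of pasts. -/
theorem IsPast.exists_steps (hρ : HasIsometricSheets π ρ) (hφ : IsBackwardContracting c φ)
    (hr : r < ρ) {ξ : ℕ → X₁} (hξ : IsPast π φ ξ) {n : ℕ} {y : X₁}
    (h : Steps (fun a b => dist a b ≤ r) n (ξ 0) y) :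
    ∃ η, η 0 = y ∧ Steps (PastStep π φ r) n ξ η := by
  obtain ⟨z, hz0, rfl, hz⟩ := h
  induction n with
  | zero => exact ⟨ξ, hz0.symm, .zero ξ⟩
  | succ n ih =>
    obtain ⟨η, hη0, hη⟩ := ih fun j hj => hz j (by omega)
    obtain ⟨θ, hθ0, hθ⟩ := (hη.isPast_right hξ).exists_step hρ hφ hr
      (show dist (η 0) (z (n + 1)) ≤ r by rw [hη0]; exact hz n (by omega))
    exact ⟨θ, hθ0, hη.trans (.single hθ)⟩

end Past

/-! ### Transport of pasts along paths -/

section Transport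

variable {X₀ X₁ : Type*} [MetricSpace X₀] [MetricSpace X₁] {π φ : C(X₁, X₀)} {c ρ r : ℝ}

/-- Transport of the past `ξ` along `γ` ends at `η`. -/
def PathTransport (π φ : X₁ → X₀) (γ : I → X₁) (ξ η : ℕ → X₁) : Prop :=
  ∃ Γ : ℕ → C(I, X₁), ⇑(Γ 0) = γ ∧ (∀ k t, π (Γ (k + 1) t) = φ (Γ k t)) ∧
    ∀ k, Γ k 0 = ξ k ∧ Γ k 1 = η k

theorem PathTransport.trans {a b e : X₁} {γ : Path a b} {γ' : Path b e} {ξ η θ : ℕ → X₁}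
    (h : PathTransport π φ γ ξ η) (h' : PathTransport π φ γ' η θ) :
    PathTransport π φ (γ.trans γ') ξ θ := by
  obtain ⟨Γ, hΓ0, hΓ, hΓe⟩ := h
  obtain ⟨Δ, hΔ0, hΔ, hΔe⟩ := h'
  let P : ∀ k, Path (ξ k) (η k) := fun k => ⟨Γ k, (hΓe k).1, (hΓe k).2⟩
  let Q : ∀ k, Path (η k) (θ k) := fun k => ⟨Δ k, (hΔe k).1, (hΔe k).2⟩
  have hP : ∀ k t, P k t = Γ k t := fun _ _ => rfl
  have hQ : ∀ k t, Q k t = Δ k t := fun _ _ => rfl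
  refine ⟨fun k => ((P k).trans (Q k)).toContinuousMap, ?_, fun k t => ?_, fun k => ?_⟩
  · funext t
    change ((P 0).trans (Q 0)) t = _
    rw [Path.trans_apply, Path.trans_apply]
    simp only [hP, hQ, hΓ0, hΔ0]
  · change π (((P (k + 1)).trans (Q (k + 1))) t) = φ (((P k).trans (Q k)) t)
    rw [Path.trans_apply, Path.trans_apply]
    split_ifs
    · simp only [hP, hΓ]
    · simp only [hQ, hΔ]
  · exact ⟨((P k).trans (Q k)).source, ((P k).trans (Q k)).target⟩

theorem exists_pathTransport (hπ : IsCoveringMap π) {ξ : ℕ → X₁} (hξ : IsPast π φ ξ) (γ : C(I, X₁))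
    (hγ : γ 0 = ξ 0) : ∃ η, PathTransport π φ γ ξ η := by
  have key : ∀ k, ∀ Γ : {Γ : C(I, X₁) // Γ 0 = ξ k}, ∃ Γ' : {Γ : C(I, X₁) // Γ 0 = ξ (k + 1)},
      ∀ t, π (Γ'.1 t) = φ (Γ.1 t) := by
    rintro k ⟨Γ, hΓ⟩
    obtain ⟨Γ', h, h'⟩ := hπ.exists_path_lifts (φ.comp Γ) (ξ (k + 1)) (by simp [hΓ, hξ k])
    exact ⟨⟨Γ', h'⟩, fun t => congrFun h t⟩
  choose g hg using key
  let Γ : (k : ℕ) → {Γ : C(I, X₁) // Γ 0 = ξ k} :=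
    fun k => Nat.rec ⟨γ, hγ⟩ (fun k b => g k b) k
  exact ⟨fun k => (Γ k).1 1, fun k => (Γ k).1, rfl, fun k => hg k (Γ k), fun k => ⟨(Γ k).2, rfl⟩⟩

/-- A homotopy rel endpoints is pushed forward by `φ` and lifted through `π` at every stage, so the
successive lifts have the same endpoints. -/
theorem PathTransport.eq_of_homotopicRel (hπ : IsCoveringMap π) {γ γ' : C(I, X₁)}
    {ξ η η' : ℕ → X₁} (hγ : γ.HomotopicRel γ' {0, 1}) (h : PathTransport π φ γ ξ η)
    (h' : PathTransport π φ γ' ξ η') : η = η' := by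
  obtain ⟨Γ, hΓ0, hΓ, hΓe⟩ := h
  obtain ⟨Δ, hΔ0, hΔ, hΔe⟩ := h'
  have key : ∀ k, (Γ k).HomotopicRel (Δ k) {0, 1} := by
    intro k
    induction k with
    | zero => rwa [DFunLike.coe_injective hΓ0, DFunLike.coe_injective hΔ0]
    | succ k ih =>
      rw [hπ.homotopicRel_iff_comp ⟨0, by simp, (hΓe _).1.trans (hΔe _).1.symm⟩]
      have h1 : ContinuousMap.comp ⟨π, hπ.continuous⟩ (Γ (k + 1)) = φ.comp (Γ k) := by
        ext t; exact hΓ k t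
      have h2 : ContinuousMap.comp ⟨π, hπ.continuous⟩ (Δ (k + 1)) = φ.comp (Δ k) := by
        ext t; exact hΔ k t
      rw [h1, h2]
      exact ih.map fun F => F.compContinuousMap φ
  funext k
  rw [← (hΓe k).2, ← (hΔe k).2]
  obtain ⟨F⟩ := key k
  exact (F.eq_fst 0 (by simp)).symm.trans (F.eq_snd 0 (by simp))

/-- Lifts of a path that is short over a connected parameter set are short over it. -/
theorem dist_le_of_lifts (hρ : HasIsometricSheets π ρ) (hφ : IsBackwardContracting c φ)
    (hr : r < ρ) {Γ : ℕ → C(I, X₁)} (hΓ : ∀ k t, π (Γ (k + 1) t) = φ (Γ k t)) {S : Set I}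
    (hS : IsPreconnected S) {s : I} (hs : s ∈ S) (h0 : ∀ t ∈ S, dist (Γ 0 s) (Γ 0 t) ≤ r) (k : ℕ) :
    ∀ t ∈ S, dist (Γ k s) (Γ k t) ≤ r := by
  induction k with
  | zero => exact h0
  | succ k ih =>
    have hr0 : 0 ≤ r := dist_nonneg.trans (h0 s hs)
    -- Below `ρ` the distance equals that of the `φ`-images, which is at most `r`. So it takes no
    -- value in `(r, ρ)`, and connectedness of `S` keeps it at most `r`.
    refine hS.forall_le_of_gap (by fun_prop) hr (fun t ht hlt => ?_) hs (by simpa using hr0)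
    rw [← hρ.isometric _ _ hlt, hΓ, hΓ]
    calc _ ≤ c * dist (Γ k s) (Γ k t) := hφ.2.2 _ _
      _ ≤ 1 * dist (Γ k s) (Γ k t) := by gcongr; exact hφ.2.1.le
      _ ≤ r := by simpa using ih t ht

theorem PathTransport.step (hρ : HasIsometricSheets π ρ) (hφ : IsBackwardContracting c φ)
    (hr : r < ρ) {γ : I → X₁} {ξ η : ℕ → X₁} (h : PathTransport π φ γ ξ η)
    (hγ : ∀ t, dist (γ 0) (γ t) ≤ r) : PastStep π φ r ξ η := by
  obtain ⟨Γ, rfl, hΓ, hΓe⟩ := h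
  refine ⟨fun k => ?_, fun k => ?_, fun k => ?_⟩
  · rw [← (hΓe _).1, ← (hΓe _).1, hΓ]
  · rw [← (hΓe _).2, ← (hΓe _).2, hΓ]
  · have := dist_le_of_lifts hρ hφ hr hΓ isPreconnected_univ (mem_univ 0) (fun t _ => hγ t) k 1
      (mem_univ 1)
    rwa [(hΓe _).1, (hΓe _).2] at this

/-- The number of steps needed to follow a path. -/
theorem exists_steps_of_pathTransport (hρ : HasIsometricSheets π ρ)
    (hφ : IsBackwardContracting c φ) (hr0 : 0 < r) (hr : r < ρ) (γ : C(I, X₁)) :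
    ∃ m, (Steps (fun a b => dist a b ≤ r) m (γ 0) (γ 1)) ∧
      ∀ ξ η, PathTransport π φ γ ξ η → Steps (PastStep π φ r) m ξ η := by
  obtain ⟨δ, hδ, hγ⟩ := Metric.uniformContinuous_iff.1
    (CompactSpace.uniformContinuous_of_continuous γ.continuous) r hr0
  obtain ⟨m, hm⟩ := exists_nat_one_div_lt hδ
  let τ : ℕ → I := fun j => projIcc 0 1 zero_le_one (j / (m + 1 : ℝ))
  have hτ0 : τ 0 = 0 := by simp [τ]
  have hτ1 : τ (m + 1) = 1 := by
    simp only [τ]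
    push_cast
    rw [div_self (by positivity)]
    simp
  have hτ : ∀ j, τ j ≤ τ (j + 1) := fun j => monotone_projIcc _ (by push_cast; gcongr; linarith)
  have hτd : ∀ j, ∀ t ∈ Icc (τ j) (τ (j + 1)), dist (γ (τ j)) (γ t) ≤ r := by
    intro j t ht
    refine (hγ ?_).le
    have h1 : (τ (j + 1) : ℝ) - τ j ≤ 1 / (m + 1) := by
      have := abs_projIcc_sub_projIcc (a := (0 : ℝ)) (b := 1) zero_le_one
        (c := ((j + 1 : ℕ) : ℝ) / (m + 1 : ℝ)) (d := (j : ℝ) / (m + 1 : ℝ))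
      refine (le_abs_self _).trans (this.trans ?_)
      rw [← sub_div, show ((j + 1 : ℕ) : ℝ) - j = 1 by push_cast; ring, abs_of_pos (by positivity)]
    have h2 : (τ j : ℝ) ≤ t := ht.1
    have h3 : (t : ℝ) ≤ τ (j + 1) := ht.2
    rw [Subtype.dist_eq, dist_comm, Real.dist_eq, abs_of_nonneg (by linarith)]
    linarith
  refine ⟨m + 1, ⟨fun j => γ (τ j), by simp [hτ0], by simp [hτ1],
    fun j _ => hτd j _ ⟨hτ j, le_rfl⟩⟩, ?_⟩
  rintro ξ η ⟨Γ, hΓ0, hΓ, hΓe⟩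
  refine ⟨fun j k => Γ k (τ j), funext fun k => by simp only [hτ0, (hΓe k).1],
    funext fun k => by simp only [hτ1, (hΓe k).2], fun j _ =>
    ⟨fun k => hΓ k _, fun k => hΓ k _, fun k => ?_⟩⟩
  refine dist_le_of_lifts hρ hφ hr hΓ isPreconnected_Icc (s := τ j) ⟨le_rfl, hτ j⟩ ?_ k _
    ⟨hτ j, le_rfl⟩
  intro t ht
  rw [hΓ0]
  exact hτd j t ht

end Transport

/-! ### Recurrence and uniform bounds on chains -/

section Recurrence

variable {X₀ X₁ : Type*} [MetricSpace X₀] [MetricSpace X₁] {π φ : C(X₁, X₀)} {c ρ r : ℝ}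

/-- Any path `h` from `a` to `b` is corrected by a loop `l` whose image represents `q` followed by
the reverse of `φ ∘ h`. -/
theorem IsRecurrent.exists_path_homotopic [PathConnectedSpace X₁] (hrec : IsRecurrent φ)
    {a b : X₁} (q : Path (φ a) (φ b)) : ∃ ω : Path a b, (ω.map φ.continuous).Homotopic q := by
  let h : Path a b := PathConnectedSpace.somePath a b
  obtain ⟨l, hl⟩ := hrec.surjective_map a
    (Path.Homotopic.Quotient.mk (q.trans (h.map φ.continuous).symm))
  obtain ⟨l, rfl⟩ := Path.Homotopic.Quotient.mk_surjective l
  refine ⟨l.trans h, ?_⟩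
  have hl' : (l.map φ.continuous).Homotopic (q.trans (h.map φ.continuous).symm) :=
    Path.Homotopic.Quotient.exact hl
  rw [Path.map_trans]
  refine (hl'.hcomp (.refl _)).trans ?_
  refine (Path.Homotopic.trans_assoc _ _ _).trans ?_
  exact ((Path.Homotopic.refl q).hcomp (Path.Homotopic.symm_trans _)).trans
    (Path.Homotopic.trans_refl q)

/-- A chain in `X₁` is filled in by a path with the same transport of pasts. -/
theorem exists_path_of_chain (hπ : IsCoveringMap π) (hρ : HasIsometricSheets π ρ)
    (hφ : IsBackwardContracting c φ) (hX₁ : IsLengthMetric X₁) (hr0 : 0 < r) (hr : 3 * r < ρ)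
    (z : ℕ → X₁) (N : ℕ) (hz : ∀ j < N, dist (z j) (z (j + 1)) ≤ r) :
    ∃ q : Path (z 0) (z N), ∀ ζ : ℕ → ℕ → X₁, IsPast π φ (ζ 0) → (∀ j ≤ N, ζ j 0 = z j) →
      (∀ j < N, PastStep π φ r (ζ j) (ζ (j + 1))) → PathTransport π φ q (ζ 0) (ζ N) := by
  induction N with
  | zero =>
    refine ⟨Path.refl _, fun ζ hζ hζz _ => ⟨fun k => ContinuousMap.const _ (ζ 0 k), ?_, ?_, ?_⟩⟩
    · ext t; simpa using hζz 0 le_rfl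
    · exact fun k t => hζ k
    · exact fun k => ⟨rfl, rfl⟩
  | succ N ih =>
    obtain ⟨q, hq⟩ := ih fun j hj => hz j (by omega)
    -- A minimizing path need not exist, hence `2 * r`. The transported past and `ζ (N + 1)` are
    -- then within `2 * r + r < ρ` of each other, so they agree.
    obtain ⟨p, hp⟩ := hX₁.exists_path ((hz N (by omega)).trans_lt (show r < 2 * r by linarith))
    refine ⟨q.trans p, fun ζ hζ hζz hζs => ?_⟩
    have h1 := hq ζ hζ (fun j hj => hζz j (by omega)) fun j hj => hζs j (by omega)
    have h2 := hζs N (by omega)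
    obtain ⟨η, hη⟩ := exists_pathTransport hπ h2.left p.toContinuousMap
      (by rw [hζz N (by omega)]; exact p.source)
    have h3 : PastStep π φ (2 * r) (ζ N) η :=
      hη.step hρ hφ (by linarith) fun t => by
        change dist (p 0) (p t) ≤ _
        rw [p.source]; exact hp t
    have h4 : η 0 = z (N + 1) := by
      obtain ⟨Γ, hΓ, -, hΓe⟩ := hη
      rw [← (hΓe 0).2, hΓ]
      exact p.target
    have h5 : η = ζ (N + 1) := by
      refine h3.right.eq_of_dist_lt hρ hφ h2.right (fun k => ?_) (h4.trans (hζz _ le_rfl).symm)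
      have := dist_triangle_left (η k) (ζ (N + 1) k) (ζ N k)
      linarith [h3.dist_le k, h2.dist_le k]
    exact h1.trans (h5 ▸ hη)

/-- Recurrence for chains: the lifts of a chain, extended by one more term at both ends, are
joined by a number of steps that depends only on the chain and the two terms. -/
theorem IsRecurrent.exists_steps_consSeq [PathConnectedSpace X₁] (hrec : IsRecurrent φ)
    (hπ : IsCoveringMap π) (hρ : HasIsometricSheets π ρ)
    (hφ : IsBackwardContracting c φ) (hX₁ : IsLengthMetric X₁) (hr0 : 0 < r) (hr : 3 * r < ρ)
    (z : ℕ → X₁) (N : ℕ) (hz : ∀ j < N, dist (z j) (z (j + 1)) ≤ r) (a b : X₁)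
    (ha : π (z 0) = φ a) (hb : π (z N) = φ b) :
    ∃ m, ∀ ζ : ℕ → ℕ → X₁, IsPast π φ (ζ 0) → (∀ j ≤ N, ζ j 0 = z j) →
      (∀ j < N, PastStep π φ r (ζ j) (ζ (j + 1))) →
      Steps (PastStep π φ r) m (consSeq a (ζ 0)) (consSeq b (ζ N)) := by
  obtain ⟨q, hq⟩ := exists_path_of_chain hπ hρ hφ hX₁ hr0 hr z N hz
  obtain ⟨ω, ⟨H⟩⟩ := hrec.exists_path_homotopic ((q.map π.continuous).cast ha.symm hb.symm)
  obtain ⟨m, -, hm⟩ := exists_steps_of_pathTransport hρ hφ hr0 (by linarith) ω.toContinuousMap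
  refine ⟨m, fun ζ hζ hζz hζs => ?_⟩
  have hqt := hq ζ hζ hζz hζs
  have hcons : IsPast π φ (consSeq a (ζ 0)) := hζ.consSeq (by rw [hζz 0 (Nat.zero_le _), ha])
  obtain ⟨θ, hθ⟩ := exists_pathTransport hπ hcons ω.toContinuousMap ω.source
  have hθ' := hm _ _ hθ
  obtain ⟨Γ, hΓ0, hΓ, hΓe⟩ := hθ
  -- The first lift `Γ 1` of `φ ∘ ω` and the path `q` start at the same point and have homotopic
  -- `π`-images, so they are homotopic and transport `ζ 0` to the same past.
  have htail : (fun k => θ (k + 1)) = ζ N := by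
    refine PathTransport.eq_of_homotopicRel hπ (γ := Γ 1) (γ' := q.toContinuousMap) ?_
      ⟨fun k => Γ (k + 1), rfl, fun k => hΓ (k + 1), fun k => hΓe (k + 1)⟩ hqt
    rw [hπ.homotopicRel_iff_comp
      ⟨0, by simp, (hΓe 1).1.trans ((hζz 0 (Nat.zero_le _)).trans q.source.symm)⟩]
    have h1 : ContinuousMap.comp ⟨π, hπ.continuous⟩ (Γ 1) =
        (ω.map φ.continuous).toContinuousMap := by
      ext t
      exact (hΓ 0 t).trans (congrArg φ (congrFun hΓ0 t))
    rw [h1]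
    exact ⟨H⟩
  have hθ0 : θ 0 = b := by
    rw [← (hΓe 0).2, hΓ0]
    exact ω.target
  have : θ = consSeq b (ζ N) := by
    funext k
    cases k with
    | zero => exact hθ0
    | succ k => exact congrFun htail k
  exact this ▸ hθ'

/-- The number of steps in `IsRecurrent.exists_steps_consSeq` can be chosen uniformly. -/
theorem IsRecurrent.exists_forall_steps_consSeq [PathConnectedSpace X₁] [CompactSpace X₁]
    (hrec : IsRecurrent φ)
    (hπ : IsCoveringMap π) (hρ : HasIsometricSheets π ρ)
    (hφ : IsBackwardContracting c φ) (hX₁ : IsLengthMetric X₁) (hr0 : 0 < r) (hr : 4 * r ≤ ρ)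
    (N : ℕ) :
    ∃ M, ∀ ξ η : ℕ → X₁, IsPast π φ ξ → Steps (PastStep π φ r) N ξ η → ∀ a b : X₁,
      π (ξ 0) = φ a → π (η 0) = φ b →
      Steps (PastStep π φ r) M (consSeq a ξ) (consSeq b η) := by
  -- The number of steps depends only on the initial terms and on `a`, `b`, not on the full pasts;
  -- these data range over a compact set.
  let D : Set ((ℕ → X₁) × X₁ × X₁) := {w | (∀ j < N, dist (w.1 j) (w.1 (j + 1)) ≤ r) ∧
    π (w.1 0) = φ w.2.1 ∧ π (w.1 N) = φ w.2.2}
  have hD : IsCompact D := by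
    have hDeq : D = (⋂ j, ⋂ (_ : j < N), {w | dist (w.1 j) (w.1 (j + 1)) ≤ r}) ∩
        ({w | π (w.1 0) = φ w.2.1} ∩ {w | π (w.1 N) = φ w.2.2}) := by
      ext w; simp [D]
    rw [hDeq]
    refine IsClosed.isCompact (.inter ?_ (.inter ?_ ?_))
    · exact isClosed_iInter fun j => isClosed_iInter fun _ =>
        isClosed_le (by fun_prop) continuous_const
    · exact isClosed_eq (by fun_prop) (by fun_prop)
    · exact isClosed_eq (by fun_prop) (by fun_prop)
  have key : ∃ M, ∀ w ∈ D, ∀ ζ : ℕ → ℕ → X₁, IsPast π φ (ζ 0) → (∀ j ≤ N, ζ j 0 = w.1 j) →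
      (∀ j < N, PastStep π φ r (ζ j) (ζ (j + 1))) →
      Steps (PastStep π φ r) M (consSeq w.2.1 (ζ 0)) (consSeq w.2.2 (ζ N)) := by
    have hpast : ∀ w ∈ D, ∀ ζ : ℕ → ℕ → X₁, IsPast π φ (ζ 0) → (∀ j ≤ N, ζ j 0 = w.1 j) →
        (∀ j < N, PastStep π φ r (ζ j) (ζ (j + 1))) → IsPast π φ (consSeq w.2.2 (ζ N)) := by
      intro w hw ζ h1 h2 h3
      refine IsPast.consSeq (Steps.isPast_right ⟨ζ, rfl, rfl, h3⟩ h1) ?_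
      rw [h2 N le_rfl, hw.2.2]
    refine hD.induction_on (p := fun A => ∃ M, ∀ w ∈ A ∩ D, ∀ ζ : ℕ → ℕ → X₁, IsPast π φ (ζ 0) →
      (∀ j ≤ N, ζ j 0 = w.1 j) → (∀ j < N, PastStep π φ r (ζ j) (ζ (j + 1))) →
      Steps (PastStep π φ r) M (consSeq w.2.1 (ζ 0)) (consSeq w.2.2 (ζ N))) ?_ ?_ ?_ ?_ |>.imp
      fun M hM w hw => hM w ⟨hw, hw⟩
    · exact ⟨0, by simp⟩
    · rintro A B hAB ⟨M, hM⟩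
      exact ⟨M, fun w hw => hM w ⟨hAB hw.1, hw.2⟩⟩
    · rintro A B ⟨M, hM⟩ ⟨M', hM'⟩
      refine ⟨max M M', ?_⟩
      rintro w ⟨hw | hw, hwD⟩ ζ h1 h2 h3
      · exact (hM w ⟨hw, hwD⟩ ζ h1 h2 h3).mono ((hpast w hwD ζ h1 h2 h3).step_self hr0.le)
          (le_max_left _ _)
      · exact (hM' w ⟨hw, hwD⟩ ζ h1 h2 h3).mono ((hpast w hwD ζ h1 h2 h3).step_self hr0.le)
          (le_max_right _ _)
    · intro w hw
      obtain ⟨m, hm⟩ := hrec.exists_steps_consSeq hπ hρ hφ hX₁ hr0 (by linarith) w.1 N hw.1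
        w.2.1 w.2.2 hw.2.1 hw.2.2
      have hr2 : 0 < r / 2 := half_pos hr0
      -- For data near `w`, every past is moved to the initial terms prescribed by `w`; the two
      -- extra steps go there and back at the ends.
      refine ⟨{v | (∀ j ∈ Finset.range (N + 1), dist (v.1 j) (w.1 j) < r / 2) ∧
        dist v.2.1 w.2.1 < r / 2 ∧ dist v.2.2 w.2.2 < r / 2},
        mem_nhdsWithin_of_mem_nhds ?_, 1 + m + 1, ?_⟩
      · have hlt : ∀ {g : (ℕ → X₁) × X₁ × X₁ → X₁}, Continuous g →
            ∀ᶠ v in 𝓝 w, dist (g v) (g w) < r / 2 := fun hg =>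
          hg.continuousAt.eventually (Metric.ball_mem_nhds _ hr2)
        refine Filter.Eventually.and ?_ ((hlt (g := fun v => v.2.1) (by fun_prop)).and
          (hlt (g := fun v => v.2.2) (by fun_prop)))
        exact (Filter.eventually_all_finset _).2 fun j _ =>
          hlt (g := fun v => v.1 j) (by fun_prop)
      · rintro v ⟨⟨hv0, hv1, hv2⟩, hvD⟩ ζ h1 h2 h3
        have hζ : ∀ j ≤ N, IsPast π φ (ζ j) := by
          intro j hj
          exact Steps.isPast_right ⟨ζ, rfl, rfl, fun i hi => h3 i (hi.trans_le hj)⟩ h1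
        have hex : ∀ j, ∃ θ, j ≤ N → θ 0 = w.1 j ∧ PastStep π φ (r / 2) (ζ j) θ := by
          intro j
          by_cases hj : j ≤ N
          · obtain ⟨θ, hθ⟩ := (hζ j hj).exists_step hρ hφ (z := w.1 j)
              (show r / 2 < ρ by linarith) (by
                rw [h2 j hj]; exact (hv0 j (by simpa [Nat.lt_succ_iff] using hj)).le)
            exact ⟨θ, fun _ => hθ⟩
          · exact ⟨ζ j, fun h => absurd h hj⟩
        choose θ hθ using hex
        have hθs : ∀ j < N, PastStep π φ r (θ j) (θ (j + 1)) := by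
          intro j hj
          have e1 := (hθ j hj.le).2
          have e2 := (hθ (j + 1) hj).2
          -- The triangle inequality gives only `2 * r`. As this is below `ρ`, contraction reduces
          -- the distances to that of the initial terms, which is at most `r`.
          have hd : ∀ k, dist (θ j k) (θ (j + 1) k) < ρ := fun k => by
            have := dist_triangle4 (θ j k) (ζ j k) (ζ (j + 1) k) (θ (j + 1) k)
            have e3 := e1.dist_le k
            rw [dist_comm] at e3
            linarith [e2.dist_le k, (h3 j hj).dist_le k]
          refine ⟨e1.right, e2.right, fun k => (e1.right.dist_le hρ hφ e2.right hd k).trans ?_⟩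
          rw [(hθ j hj.le).1, (hθ (j + 1) hj).1]
          exact hw.1 j hj
        have hmid := hm θ (hθ 0 (Nat.zero_le _)).2.right (fun j hj => (hθ j hj).1) hθs
        have hstep : ∀ (j : ℕ) (a a' : X₁), j ≤ N → π (v.1 j) = φ a → π (w.1 j) = φ a' →
            dist a a' < r / 2 → PastStep π φ r (consSeq a (ζ j)) (consSeq a' (θ j)) := by
          intro j a a' hj ha ha' hd
          refine ⟨(hζ j hj).consSeq (by rw [h2 j hj, ha]),
            (hθ j hj).2.right.consSeq (by rw [(hθ j hj).1, ha']), fun k => ?_⟩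
          cases k with
          | zero => exact hd.le.trans (by linarith)
          | succ k => exact ((hθ j hj).2.dist_le k).trans (by linarith)
        exact ((Steps.single (hstep 0 _ _ (Nat.zero_le _) hvD.2.1 hw.2.1 hv1)).trans hmid).trans
          (.single (hstep N _ _ le_rfl hvD.2.2 hw.2.2 hv2).symm)
  obtain ⟨M, hM⟩ := key
  refine ⟨M, ?_⟩
  rintro ξ η hξ ⟨ζ, rfl, rfl, hζ⟩ a b ha hb
  exact hM (fun j => ζ j 0, a, b) ⟨fun j hj => (hζ j hj).dist_le 0, ha, hb⟩ ζ hξ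
    (fun _ _ => rfl) hζ

/-- Any two points of a compact path connected space are joined by a chain of uniformly bounded
length. -/
theorem exists_forall_steps_dist {X : Type*} [MetricSpace X] [CompactSpace X]
    [PathConnectedSpace X] (hr0 : 0 < r) :
    ∃ N, ∀ x y : X, Steps (fun a b => dist a b ≤ r) N x y := by
  have hself : ∀ x : X, dist x x ≤ r := fun x => by simpa using hr0.le
  obtain ⟨N, hN⟩ := (isCompact_univ (X := X × X)).induction_on
    (p := fun A => ∃ N, ∀ w ∈ A, Steps (fun a b : X => dist a b ≤ r) N w.1 w.2)
    ⟨0, by simp⟩ (fun A B hAB ⟨N, hN⟩ => ⟨N, fun w hw => hN w (hAB hw)⟩)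
    (fun A B ⟨N, hN⟩ ⟨N', hN'⟩ => ⟨max N N', fun w hw => hw.elim
      (fun h => (hN w h).mono (hself _) (le_max_left _ _))
      (fun h => (hN' w h).mono (hself _) (le_max_right _ _))⟩) (by
    rintro ⟨x, y⟩ -
    obtain ⟨m, hm⟩ : ∃ m, Steps (fun a b : X => dist a b ≤ r) m x y := by
      let γ : Path x y := PathConnectedSpace.somePath x y
      obtain ⟨m, hm, -⟩ := exists_steps_of_pathTransport (π := .id X)
        (φ := .const X x) (c := 1 / 2) (ρ := r + 1) ⟨by linarith, fun a b _ => rfl,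
          fun a z _ => ⟨z, rfl, rfl⟩⟩ ⟨by norm_num, by norm_num, by simp⟩ hr0 (by linarith)
        γ.toContinuousMap
      have h0 : γ.toContinuousMap 0 = x := γ.source
      have h1 : γ.toContinuousMap 1 = y := γ.target
      rw [h0, h1] at hm
      exact ⟨m, hm⟩
    refine ⟨Metric.ball x r ×ˢ Metric.ball y r, mem_nhdsWithin_of_mem_nhds
      (prod_mem_nhds (Metric.ball_mem_nhds _ hr0) (Metric.ball_mem_nhds _ hr0)), 1 + m + 1, ?_⟩
    rintro ⟨x', y'⟩ ⟨hx, hy⟩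
    have h1 : Steps (fun a b : X => dist a b ≤ r) 1 x' x := .single (Metric.mem_ball.1 hx).le
    have h2 : Steps (fun a b : X => dist a b ≤ r) 1 y y' := .single (Metric.mem_ball'.1 hy).le
    exact (h1.trans hm).trans h2)
  exact ⟨N, fun x y => hN (x, y) (mem_univ _)⟩

end Recurrence

/-! ### Compact metric spaces: fine chains and coordinates -/

section Metric

/-- In a compact Hausdorff space a component is the intersection of the clopen sets containing it. A
chain finer than the Lebesgue number of a clopen set and its complement cannot cross between them.
-/
theorem mem_connectedComponentIn_of_chains {X : Type*} [MetricSpace X] [CompactSpace X] {Q : Set X}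
    (hQ : IsClosed Q) {x y : X} (hx : x ∈ Q)
    (h : ∀ δ > 0, Relation.ReflTransGen (fun a b => a ∈ Q ∧ b ∈ Q ∧ dist a b < δ) x y) :
    y ∈ connectedComponentIn Q x := by
  have : CompactSpace Q := isCompact_iff_compactSpace.1 hQ.isCompact
  have hyQ : y ∈ Q := by
    rcases (Relation.ReflTransGen.cases_tail (h 1 one_pos)) with rfl | ⟨b, -, hb⟩
    · exact hx
    · exact hb.2.1
  rw [connectedComponentIn_eq_image hx]
  refine ⟨⟨y, hyQ⟩, ?_, rfl⟩
  rw [connectedComponent_eq_iInter_isClopen, mem_iInter]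
  rintro ⟨Z, hZ, hxZ⟩
  obtain ⟨δ, hδ, hcov⟩ := lebesgue_number_lemma_of_metric (isCompact_univ (X := Q))
    (c := fun b : Bool => if b then Z else Zᶜ)
    (by rintro (_ | _) <;> simp [hZ.isOpen, hZ.isClosed])
    (fun q _ => mem_iUnion.2 (by
      by_cases hq : q ∈ Z
      · exact ⟨true, by simpa⟩
      · exact ⟨false, by simpa⟩))
  have key : ∀ b, Relation.ReflTransGen (fun a b => a ∈ Q ∧ b ∈ Q ∧ dist a b < δ) x b →
      ∀ hb : b ∈ Q, (⟨b, hb⟩ : Q) ∈ Z := by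
    intro b hb
    induction hb with
    | refl => exact fun _ => hxZ
    | @tail a b _ hab ih =>
      intro hb
      have ha := ih hab.1
      obtain ⟨i, hi⟩ := hcov ⟨a, hab.1⟩ (mem_univ _)
      have ha' := hi (Metric.mem_ball_self hδ)
      have hb' := hi (show (⟨b, hb⟩ : Q) ∈ Metric.ball ⟨a, hab.1⟩ δ by
        rw [Metric.mem_ball']; exact hab.2.2)
      cases i with
      | true => simpa using hb'
      | false => exact absurd ha (by simpa using ha')
  exact key y (h δ hδ) hyQ

/-- On a compact space, closeness in finitely many members of a separating sequence of continuous
functions implies closeness in any compatible metric. -/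
theorem IsCompatibleMetric.exists_forall_dist_lt {X Y : Type*} [TopologicalSpace X] [CompactSpace X]
    [MetricSpace Y] {m : MetricSpace X} (hm : IsCompatibleMetric m) {g : ℕ → X → Y}
    (hg : ∀ i, Continuous (g i)) (hsep : ∀ x y, (∀ i, g i x = g i y) → x = y) {δ : ℝ} (hδ : 0 < δ) :
    ∃ n : ℕ, ∃ η > 0, ∀ x y, (∀ i ≤ n, dist (g i x) (g i y) < η) → m.dist x y < δ := by
  unfold IsCompatibleMetric at hm
  subst hm
  have hK : IsCompact {w : X × X | δ ≤ dist w.1 w.2} :=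
    (isClosed_le continuous_const (by fun_prop)).isCompact
  -- Each pair at distance at least `δ` is separated by one function, uniformly on a neighbourhood;
  -- finitely many neighbourhoods suffice.
  obtain ⟨n, η, hη, h⟩ := hK.induction_on
    (p := fun A => ∃ n : ℕ, ∃ η > 0, ∀ w ∈ A, ∃ i ≤ n, η ≤ dist (g i w.1) (g i w.2))
    ⟨0, 1, one_pos, by simp⟩
    (fun A B hAB ⟨n, η, hη, h⟩ => ⟨n, η, hη, fun w hw => h w (hAB hw)⟩)
    (fun A B ⟨n, η, hη, h⟩ ⟨n', η', hη', h'⟩ => ⟨max n n', min η η', lt_min hη hη', fun w hw =>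
      hw.elim
        (fun hw => (h w hw).imp fun i hi => ⟨hi.1.trans (le_max_left _ _),
          (min_le_left _ _).trans hi.2⟩)
        (fun hw => (h' w hw).imp fun i hi => ⟨hi.1.trans (le_max_right _ _),
          (min_le_right _ _).trans hi.2⟩)⟩) (by
    rintro ⟨x, y⟩ hxy
    obtain ⟨i, hi⟩ : ∃ i, g i x ≠ g i y := by
      by_contra! hall
      obtain rfl := hsep x y hall
      have hxy' : δ ≤ dist x x := hxy
      rw [dist_self] at hxy'
      linarith
    have hpos : 0 < dist (g i x) (g i y) := dist_pos.2 hi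
    have hcont : Continuous fun w : X × X => dist (g i w.1) (g i w.2) := by
      have := hg i
      fun_prop
    refine ⟨{w | dist (g i x) (g i y) / 2 < dist (g i w.1) (g i w.2)},
      mem_nhdsWithin_of_mem_nhds ((isOpen_lt continuous_const hcont).mem_nhds
        (half_lt_self hpos)), i, dist (g i x) (g i y) / 2, half_pos hpos,
      fun w hw => ⟨i, le_rfl, le_of_lt hw⟩⟩)
  refine ⟨n, η, hη, fun x y hxy => ?_⟩
  by_contra! hle
  obtain ⟨i, hi, hi'⟩ := h (x, y) hle
  exact absurd (hxy i hi) (not_lt.2 hi')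

theorem IsCompatibleMetric.exists_pos_forall_dist_lt {X Y : Type*} [TopologicalSpace X]
    [CompactSpace X] [MetricSpace Y] {m : MetricSpace X} (hm : IsCompatibleMetric m) {g : X → Y}
    (hg : Continuous g) {η : ℝ} (hη : 0 < η) :
    ∃ e > 0, ∀ x y, m.dist x y ≤ e → dist (g x) (g y) < η := by
  unfold IsCompatibleMetric at hm
  subst hm
  obtain ⟨e, he, h⟩ := Metric.uniformContinuous_iff.1
    (CompactSpace.uniformContinuous_of_continuous hg) η hη
  exact ⟨e / 2, half_pos he, fun x y hxy => h (lt_of_le_of_lt hxy (half_lt_self he))⟩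

end Metric

/-! ### Topology of the limit space -/

namespace LimitSpace

section Basic

variable {X₀ X₁ : Type*} {π φ : X₁ → X₀}

theorem ext_coord {x y : LimitSpace π φ} (h : ∀ i, x.1 i = y.1 i) : x = y :=
  Subtype.ext (funext h)

variable [MetricSpace X₁]

theorem continuous_coord (i : ℕ) : Continuous fun x : LimitSpace π φ => x.1 i :=
  (continuous_apply i).comp continuous_subtype_val

theorem metrizableSpace (π φ : X₁ → X₀) : TopologicalSpace.MetrizableSpace (LimitSpace π φ) :=
  have : TopologicalSpace.MetrizableSpace (ℕ → X₁) := UniformSpace.metrizableSpace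
  IsEmbedding.subtypeVal.metrizableSpace (X := {x : ℕ → X₁ // ∀ i, π (x i) = φ (x (i + 1))})

theorem mem_nhds_of_coords (x : LimitSpace π φ) (n : ℕ) {δ : ℝ} (hδ : 0 < δ) :
    {y : LimitSpace π φ | ∀ i ≤ n, dist (x.1 i) (y.1 i) < δ} ∈ 𝓝 x := by
  have : ∀ᶠ y : LimitSpace π φ in 𝓝 x, ∀ i ∈ Finset.range (n + 1), dist (x.1 i) (y.1 i) < δ := by
    refine (Filter.eventually_all_finset _).2 fun i _ => ?_
    have := (continuous_coord (π := π) (φ := φ) i).continuousAt.eventually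
      (Metric.ball_mem_nhds (x.1 i) hδ)
    filter_upwards [this] with y hy
    exact Metric.mem_ball'.1 hy
  filter_upwards [this] with y hy i hi
  exact hy i (by simpa [Nat.lt_succ_iff] using hi)

theorem exists_coords_subset [CompactSpace (LimitSpace π φ)] {x : LimitSpace π φ}
    {U : Set (LimitSpace π φ)} (hU : U ∈ 𝓝 x) :
    ∃ n : ℕ, ∃ δ > 0, {y : LimitSpace π φ | ∀ i ≤ n, dist (x.1 i) (y.1 i) < δ} ⊆ U := by
  have := metrizableSpace π φ
  let m := TopologicalSpace.metrizableSpaceMetric (LimitSpace π φ)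
  obtain ⟨ε, hε, hεU⟩ := Metric.mem_nhds_iff.1 hU
  obtain ⟨n, δ, hδ, h⟩ := IsCompatibleMetric.exists_forall_dist_lt (m := m) rfl
    (g := fun i (x : LimitSpace π φ) => x.1 i) continuous_coord (fun x y => ext_coord) hε
  exact ⟨n, δ, hδ, fun y hy => hεU (Metric.mem_ball'.2 (h x y hy))⟩

variable [TopologicalSpace X₀] [T2Space X₀]

theorem isClosed_setOf_orbits (hπ : Continuous π) (hφ : Continuous φ) :
    IsClosed {x : ℕ → X₁ | ∀ i, π (x i) = φ (x (i + 1))} := by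
  have : {x : ℕ → X₁ | ∀ i, π (x i) = φ (x (i + 1))} =
      ⋂ i, {x | π (x i) = φ (x (i + 1))} := by ext; simp
  rw [this]
  exact isClosed_iInter fun i => isClosed_eq (by fun_prop) (by fun_prop)

theorem compactSpace [CompactSpace X₁] (hπ : Continuous π) (hφ : Continuous φ) :
    CompactSpace (LimitSpace π φ) :=
  isCompact_iff_compactSpace.1 (isClosed_setOf_orbits hπ hφ).isCompact

/-- The orbit conditions up to `n` define nested compact sets, each containing a past read in
reverse. -/
theorem nonempty [CompactSpace X₁] [Nonempty X₁] (hπ : Continuous π) (hφ : Continuous φ)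
    (hsurj : Function.Surjective π) : Nonempty (LimitSpace π φ) := by
  have hne := IsCompact.nonempty_iInter_of_sequence_nonempty_isCompact_isClosed
    (fun n : ℕ => ⋂ i, ⋂ (_ : i < n), {x : ℕ → X₁ | π (x i) = φ (x (i + 1))})
    (fun n x hx => by
      simp only [mem_iInter] at hx ⊢
      exact fun i hi => hx i (by omega))
    (fun n => by
      obtain ⟨ξ, hξ, -⟩ := exists_isPast (φ := φ) hsurj (Classical.arbitrary X₁)
      refine ⟨fun i => ξ (n - i), ?_⟩
      simp only [mem_iInter]
      intro i hi
      change π (ξ (n - i)) = φ (ξ (n - (i + 1)))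
      rw [← hξ, show n - (i + 1) + 1 = n - i by omega])
    ((isClosed_iInter fun i => isClosed_iInter fun _ =>
      isClosed_eq (by fun_prop) (by fun_prop)).isCompact)
    (fun n => isClosed_iInter fun i => isClosed_iInter fun _ =>
      isClosed_eq (by fun_prop) (by fun_prop))
  obtain ⟨x, hx⟩ := hne
  simp only [mem_iInter] at hx
  exact ⟨⟨x, fun i => hx (i + 1) i (by omega)⟩⟩

end Basic

end LimitSpace

/-! ### Two-sided orbits and the refinement of links -/

section TwoSided

variable {X₀ X₁ : Type*} {π φ : X₁ → X₀}

/-- A two-sided infinite orbit. -/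
def IsTwoSidedOrbit (π φ : X₁ → X₀) (u : ℤ → X₁) : Prop := ∀ i, π (u i) = φ (u (i + 1))

/-- The terms of a two-sided sequence from the index `n` backwards. -/
def pastAt {X : Type*} (u : ℤ → X) (n : ℤ) : ℕ → X := fun k => u (n - k)

theorem IsTwoSidedOrbit.isPast_pastAt {u : ℤ → X₁} (hu : IsTwoSidedOrbit π φ u) (n : ℤ) :
    IsPast π φ (pastAt u n) := by
  intro k
  have := hu (n - (k + 1))
  rw [show n - ((k : ℤ) + 1) + 1 = n - k by ring] at this
  simpa [pastAt] using this

theorem pastAt_zero {X : Type*} (u : ℤ → X) (n : ℤ) : pastAt u n 0 = u n := by simp [pastAt]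

theorem pastAt_toNat {X : Type*} (u : ℤ → X) {n i : ℤ} (h : i ≤ n) :
    pastAt u n (n - i).toNat = u i := by
  simp only [pastAt]
  congr 1
  omega

theorem pastAt_succ {X : Type*} (u : ℤ → X) (n : ℤ) :
    pastAt u (n + 1) = consSeq (u (n + 1)) (pastAt u n) := by
  funext k
  cases k with
  | zero => simp [pastAt, consSeq]
  | succ k =>
    simp only [pastAt, consSeq]
    congr 1
    push_cast
    ring

/-- A past and a future with a common term form a two-sided orbit. -/
theorem IsPast.exists_isTwoSidedOrbit {θ : ℕ → X₁} (hθ : IsPast π φ θ) {w : ℤ → X₁} {n : ℤ}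
    (hw : ∀ i ≥ n, π (w i) = φ (w (i + 1))) (h : θ 0 = w n) :
    ∃ u, IsTwoSidedOrbit π φ u ∧ pastAt u n = θ ∧ ∀ i ≥ n, u i = w i := by
  refine ⟨fun i => if n ≤ i then w i else θ (n - i).toNat, fun i => ?_, funext fun k => ?_,
    fun i hi => if_pos hi⟩
  · rcases le_or_gt n i with hi | hi
    · simp only [hi, show n ≤ i + 1 by omega, if_true]
      exact hw i hi
    · simp only [show ¬ n ≤ i by omega, if_false]
      have := hθ (n - (i + 1)).toNat
      rw [show (n - (i + 1)).toNat + 1 = (n - i).toNat by omega] at this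
      rw [this]
      split_ifs with h1
      · rw [show i + 1 = n by omega, ← h]
        simp
      · rfl
  · simp only [pastAt]
    split_ifs with h1
    · obtain rfl : k = 0 := by omega
      simpa using h.symm
    · congr 1
      omega

/-- The one-sided orbit underlying a two-sided orbit. -/
def IsTwoSidedOrbit.toLimitSpace {u : ℤ → X₁} (hu : IsTwoSidedOrbit π φ u) : LimitSpace π φ :=
  ⟨fun i => u i, fun i => by simpa using hu i⟩

/-- Extend a point of the limit space by a past of one of its terms. -/
theorem LimitSpace.exists_isTwoSidedOrbit (x : LimitSpace π φ) {θ : ℕ → X₁} (hθ : IsPast π φ θ)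
    {n : ℕ} (h : θ 0 = x.1 n) :
    ∃ u, IsTwoSidedOrbit π φ u ∧ pastAt u n = θ ∧ ∀ i : ℕ, n ≤ i → u i = x.1 i := by
  obtain ⟨u, hu, hun, huw⟩ := hθ.exists_isTwoSidedOrbit (w := fun i => x.1 i.toNat) (n := n)
    (fun i hi => by
      have := x.2 i.toNat
      rwa [show i.toNat + 1 = (i + 1).toNat by omega] at this) (by simpa using h)
  exact ⟨u, hu, hun, fun i hi => by simpa using huw i (by exact_mod_cast hi)⟩

variable [MetricSpace X₁]

/-- Two orbits whose pasts at the time `n` are joined by `N` steps. -/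
structure LinkedAt (π φ : X₁ → X₀) (r : ℝ) (N : ℕ) (n : ℤ) (u v : ℤ → X₁) : Prop where
  left : IsTwoSidedOrbit π φ u
  right : IsTwoSidedOrbit π φ v
  steps : Steps (PastStep π φ r) N (pastAt u n) (pastAt v n)

/-- `v` stays close to `u` up to the time `n`, at distances that decay geometrically in the past. -/
def NearUpTo (B c : ℝ) (n : ℤ) (u v : ℤ → X₁) : Prop :=
  ∀ i ≤ n, dist (u i) (v i) ≤ B * c ^ (n - i).toNat

variable [MetricSpace X₀] {c ρ r : ℝ}

theorem LinkedAt.nearUpTo (hρ : HasIsometricSheets π ρ) (hφ : IsBackwardContracting c φ)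
    (hr : r < ρ) {N : ℕ} {n : ℤ} {u v : ℤ → X₁} (h : LinkedAt π φ r N n u v) :
    NearUpTo (N * r) c n u v := by
  intro i hi
  have := h.steps.dist_past_le hρ hφ hr (n - i).toNat
  rwa [pastAt_toNat u hi, pastAt_toNat v hi] at this

/-- A link is a composition of boundedly many links at the next time. -/
theorem exists_steps_linkedAt_succ {N' N M : ℕ} (hρ : HasIsometricSheets π ρ)
    (hφ : IsBackwardContracting c φ) (hr0 : 0 < r) (hr : r < ρ)
    (hN' : ∀ x y : X₁, Steps (fun a b => dist a b ≤ r) N' x y) (hN : N' + 1 + N' ≤ N)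
    (hM : ∀ ξ η : ℕ → X₁, IsPast π φ ξ → Steps (PastStep π φ r) N ξ η → ∀ a b : X₁,
      π (ξ 0) = φ a → π (η 0) = φ b →
      Steps (PastStep π φ r) M (consSeq a ξ) (consSeq b η))
    {n : ℤ} {u v : ℤ → X₁} (h : LinkedAt π φ r N n u v) :
    Steps (LinkedAt π φ r N (n + 1)) (M + 1) u v := by
  have h1 := hM _ _ (h.left.isPast_pastAt n) h.steps (u (n + 1)) (v (n + 1))
    (by rw [pastAt_zero]; exact h.left n) (by rw [pastAt_zero]; exact h.right n)
  rw [← pastAt_succ, ← pastAt_succ] at h1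
  -- Using `M + 1` steps keeps the two ends of the chain at distinct indices even when `M = 0`.
  obtain ⟨ζ, hζ0, hζM, hζ⟩ :=
    h1.mono ((h.right.isPast_pastAt (n + 1)).step_self hr0.le) M.le_succ
  have hpast : ∀ j ≤ M + 1, IsPast π φ (ζ j) := fun j hj =>
    Steps.isPast_right ⟨ζ, rfl, rfl, fun i hi => hζ i (hi.trans_le hj)⟩
      (hζ0 ▸ h.left.isPast_pastAt (n + 1))
  -- The intermediate pasts need futures: each is moved by `N'` steps to the term `u (n + 1)` and
  -- continued by `u`. Neighbours are then joined through `N' + 1 + N'` steps, while the ends remain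
  -- `u` and `v`.
  have hex : ∀ j, ∃ w, (j = 0 → w = u) ∧ (j = M + 1 → w = v) ∧ (j ≤ M + 1 →
      IsTwoSidedOrbit π φ w ∧ Steps (PastStep π φ r) N' (ζ j) (pastAt w (n + 1))) := by
    intro j
    have hz : ∀ {θ : ℕ → X₁}, IsPast π φ θ → Steps (PastStep π φ r) N' θ θ := fun hθ =>
      (Steps.zero _).mono (hθ.step_self hr0.le) (Nat.zero_le _)
    rcases Nat.eq_zero_or_pos j with rfl | hj0
    · refine ⟨u, fun _ => rfl, fun hh => by omega, fun _ => ⟨h.left, ?_⟩⟩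
      rw [hζ0]
      exact hz (h.left.isPast_pastAt _)
    rcases eq_or_ne j (M + 1) with rfl | hj1
    · refine ⟨v, fun hh => by omega, fun _ => rfl, fun _ => ⟨h.right, ?_⟩⟩
      rw [hζM]
      exact hz (h.right.isPast_pastAt _)
    by_cases hj : j ≤ M + 1
    · obtain ⟨θ, hθ0, hθ⟩ := (hpast j hj).exists_steps hρ hφ hr (hN' (ζ j 0) (u (n + 1)))
      obtain ⟨w, hw, hwθ, -⟩ := (hθ.isPast_right (hpast j hj)).exists_isTwoSidedOrbit
        (w := u) (n := n + 1) (fun i _ => h.left i) hθ0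
      exact ⟨w, fun hh => by omega, fun hh => absurd hh hj1, fun _ => ⟨hw, hwθ.symm ▸ hθ⟩⟩
    · exact ⟨u, fun _ => rfl, fun hh => absurd hh hj1, fun hh => absurd hh hj⟩
  choose w hw0 hw1 hw using hex
  refine ⟨w, hw0 0 rfl, hw1 _ rfl, fun j hj => ⟨(hw j hj.le).1, (hw (j + 1) hj).1, ?_⟩⟩
  refine Steps.mono (((hw (j + 1) hj).1.isPast_pastAt _).step_self hr0.le) hN ?_
  exact (((hw j hj.le).2.symm fun _ _ => PastStep.symm).trans (.single (hζ j hj))).trans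
    (hw (j + 1) hj).2

/-- Links can be refined to links at arbitrarily late times without going far away. -/
theorem exists_chain_linkedAt (hρ : HasIsometricSheets π ρ)
    (hφ : IsBackwardContracting c φ) (hr0 : 0 < r) (hr : r < ρ) {N M : ℕ}
    (hM : ∀ (n : ℤ) (u v : ℤ → X₁), LinkedAt π φ r N n u v →
      Steps (LinkedAt π φ r N (n + 1)) M u v)
    {B : ℝ} (hB : N * r ≤ B) (hB' : (M * (N * r) + B) * c ≤ B) (k : ℕ) :
    ∀ (n : ℤ) (u v : ℤ → X₁), LinkedAt π φ r N n u v →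
      Relation.ReflTransGen (fun w w' => LinkedAt π φ r N (n + k) w w' ∧
        NearUpTo B c n u w ∧ NearUpTo B c n u w') u v := by
  have hc := hφ.1
  have hNr : 0 ≤ N * r := by positivity
  induction k with
  | zero =>
    intro n u v h
    refine .single ⟨by simpa using h, fun i _ => ?_, fun i hi => ?_⟩
    · rw [dist_self]
      exact mul_nonneg (hNr.trans hB) (by positivity)
    · exact (h.nearUpTo hρ hφ hr i hi).trans (by gcongr)
  | succ k ih =>
    intro n u v h
    obtain ⟨w, rfl, rfl, hw⟩ := hM n u v h
    have hd : ∀ j ≤ M, NearUpTo (j * (N * r)) c (n + 1) (w 0) (w j) := by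
      intro j hj
      induction j with
      | zero => intro i _; simp
      | succ j ihj =>
        intro i hi
        have h1 := ihj (by omega) i hi
        have h2 := (hw j hj).nearUpTo hρ hφ hr i hi
        push_cast
        linarith [dist_triangle (w 0 i) (w j i) (w (j + 1) i)]
    -- Measured from time `n` instead of `n + 1`, the bounds gain a factor `c`; this absorbs the
    -- cost of the `j` preceding links through `hB'`.
    have hnear : ∀ j ≤ M, ∀ a, NearUpTo B c (n + 1) (w j) a → NearUpTo B c n (w 0) a := by
      intro j hj a ha i hi
      have h1 := hd j hj i (by omega)
      have h2 := ha i (by omega)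
      have hjM : (j : ℝ) * (N * r) ≤ M * (N * r) := by gcongr
      have hpow : c ^ (n + 1 - i).toNat = c ^ (n - i).toNat * c := by
        rw [← pow_succ]
        congr 1
        omega
      have hp : 0 ≤ c ^ (n - i).toNat := by positivity
      rw [hpow] at h1 h2
      have h3 : (j * (N * r) + B) * c ≤ B :=
        (mul_le_mul_of_nonneg_right (by linarith) hc.le).trans hB'
      calc dist (w 0 i) (a i) ≤ dist (w 0 i) (w j i) + dist (w j i) (a i) := dist_triangle _ _ _
        _ ≤ (j * (N * r) + B) * c * c ^ (n - i).toNat := by linarith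
        _ ≤ B * c ^ (n - i).toNat := mul_le_mul_of_nonneg_right h3 hp
    have hchain : ∀ j ≤ M, Relation.ReflTransGen (fun a b =>
        LinkedAt π φ r N (n + (k + 1 : ℕ)) a b ∧
        NearUpTo B c n (w 0) a ∧ NearUpTo B c n (w 0) b) (w 0) (w j) := by
      intro j hj
      induction j with
      | zero => exact .refl
      | succ j ihj =>
        refine (ihj (by omega)).trans (Relation.ReflTransGen.mono ?_ _ _ (ih (n + 1) _ _ (hw j hj)))
        rintro a b ⟨hab, ha, hb⟩
        refine ⟨?_, hnear j (by omega) a ha, hnear j (by omega) b hb⟩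
        rwa [show n + ((k + 1 : ℕ) : ℤ) = n + 1 + k by push_cast; ring]
    exact hchain M le_rfl

end TwoSided

/-! ### Connected pieces of cylinders -/

namespace LimitSpace

section Connected

variable {X₀ X₁ : Type*} {π φ : X₁ → X₀}

/-- A two-sided extension of a point of the limit space. -/
theorem exists_extension (hsurj : Function.Surjective π) (x : LimitSpace π φ) :
    ∃ u, IsTwoSidedOrbit π φ u ∧ ∀ i : ℕ, u i = x.1 i := by
  obtain ⟨θ, hθ, hθ0⟩ := exists_isPast (φ := φ) hsurj (x.1 0)
  obtain ⟨u, hu, -, hux⟩ := x.exists_isTwoSidedOrbit (n := 0) hθ hθ0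
  exact ⟨u, hu, fun i => hux i (Nat.zero_le i)⟩

theorem shift_iterate_coord (n : ℕ) (x : LimitSpace π φ) (i : ℕ) :
    ((shift π φ)^[n] x).1 i = x.1 (i + n) := by
  induction n generalizing x with
  | zero => rfl
  | succ n ih =>
    rw [Function.iterate_succ_apply, ih]
    change x.1 (i + n + 1) = _
    rw [Nat.add_assoc]

variable [MetricSpace X₁]

/-- The points of the limit space whose first terms are close to those of `x`. -/
def cylinder (B c : ℝ) (n : ℕ) (x : LimitSpace π φ) : Set (LimitSpace π φ) :=
  {y | ∀ i ≤ n, dist (x.1 i) (y.1 i) ≤ B * c ^ (n - i)}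


theorem isClosed_cylinder (B c : ℝ) (n : ℕ) (x : LimitSpace π φ) : IsClosed (cylinder B c n x) := by
  have : cylinder B c n x = ⋂ i, ⋂ (_ : i ≤ n), {y | dist (x.1 i) (y.1 i) ≤ B * c ^ (n - i)} := by
    ext; simp [cylinder]
  rw [this]
  exact isClosed_iInter fun i => isClosed_iInter fun _ =>
    isClosed_le (continuous_const.dist (continuous_coord i)) continuous_const

variable [MetricSpace X₀] {c ρ r : ℝ}

/-- Linked orbits lie in a common component of a cylinder. -/
theorem mem_connectedComponentIn_cylinder [CompactSpace (LimitSpace π φ)]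
    (hρ : HasIsometricSheets π ρ) (hφ : IsBackwardContracting c φ) (hr : r < ρ) {N : ℕ} {B : ℝ}
    (hB : 0 ≤ B)
    (hchain : ∀ (k : ℕ) (n : ℤ) (u v : ℤ → X₁), LinkedAt π φ r N n u v →
      Relation.ReflTransGen (fun w w' => LinkedAt π φ r N (n + k) w w' ∧
        NearUpTo B c n u w ∧ NearUpTo B c n u w') u v)
    {x y : LimitSpace π φ} {n : ℕ} {u v : ℤ → X₁} (h : LinkedAt π φ r N n u v)
    (hu : ∀ i : ℕ, u i = x.1 i) (hv : ∀ i : ℕ, v i = y.1 i) :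
    y ∈ connectedComponentIn (cylinder B c n x) x := by
  classical
  have := metrizableSpace π φ
  let m := TopologicalSpace.metrizableSpaceMetric (LimitSpace π φ)
  refine mem_connectedComponentIn_of_chains (isClosed_cylinder B c n x) (fun i _ => ?_) ?_
  · rw [dist_self]
    exact mul_nonneg hB (pow_nonneg hφ.1.le _)
  intro δ hδ
  obtain ⟨n₀, η, hη, hclose⟩ := IsCompatibleMetric.exists_forall_dist_lt (m := m) rfl
    (g := fun i (x : LimitSpace π φ) => x.1 i) continuous_coord (fun x y => ext_coord) hδ
  obtain ⟨k, hk⟩ : ∃ k : ℕ, N * r * c ^ k < η := by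
    have := (tendsto_pow_atTop_nhds_zero_of_lt_one hφ.1.le hφ.2.1).const_mul (N * r)
    rw [mul_zero] at this
    exact (this.eventually_lt_const hη).exists
  -- The value `x` off the orbits is a dummy: links hold only between orbits.
  let F : (ℤ → X₁) → LimitSpace π φ := fun w =>
    if hw : IsTwoSidedOrbit π φ w then hw.toLimitSpace else x
  have hF : ∀ {w}, IsTwoSidedOrbit π φ w → ∀ i : ℕ, (F w).1 i = w i := by
    intro w hw i
    simp only [F, hw, dif_pos]
    rfl
  have hFu : F u = x := ext_coord fun i => by rw [hF h.left, hu]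
  have hFv : F v = y := ext_coord fun i => by rw [hF h.right, hv]
  suffices hlift : Relation.ReflTransGen
      (fun a b => a ∈ cylinder B c n x ∧ b ∈ cylinder B c n x ∧ dist a b < δ) (F u) (F v) by
    rwa [hFu, hFv] at hlift
  -- At time `n + n₀ + k` linked orbits have `η`-close coordinates up to `n₀`, hence are `δ`-close
  -- in the limit space.
  refine Relation.ReflTransGen.lift F ?_ _ _ (hchain (n₀ + k) n u v h)
  rintro a b ⟨hab, ha, hb⟩
  have hcyl : ∀ {w}, IsTwoSidedOrbit π φ w → NearUpTo B c n u w → F w ∈ cylinder B c n x := by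
    intro w hw hnear i hi
    have := hnear i (by exact_mod_cast hi)
    rwa [hF hw, ← hu, show n - i = ((n : ℤ) - i).toNat by omega]
  refine ⟨hcyl hab.left ha, hcyl hab.right hb, hclose _ _ fun i hi => ?_⟩
  rw [hF hab.left, hF hab.right]
  refine (hab.nearUpTo hρ hφ hr i (by push_cast; omega)).trans_lt (lt_of_le_of_lt ?_ hk)
  have hr' : 0 ≤ N * r := by
    have := hab.nearUpTo hρ hφ hr _ le_rfl
    simpa using dist_nonneg.trans this
  exact mul_le_mul_of_nonneg_left
    (pow_le_pow_of_le_one hφ.1.le hφ.2.1.le (by push_cast; omega)) hr'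

theorem exists_linkedAt_zero (hsurj : Function.Surjective π)
    (hρ : HasIsometricSheets π ρ) (hφ : IsBackwardContracting c φ) (hr : r < ρ) {N : ℕ}
    (hN : ∀ x y : X₁, Steps (fun a b => dist a b ≤ r) N x y) (x y : LimitSpace π φ) :
    ∃ u v, LinkedAt π φ r N 0 u v ∧ (∀ i : ℕ, u i = x.1 i) ∧ ∀ i : ℕ, v i = y.1 i := by
  obtain ⟨u, hu, hux⟩ := exists_extension hsurj x
  obtain ⟨η, hη0, hη⟩ := (hu.isPast_pastAt 0).exists_steps hρ hφ hr (hN _ (y.1 0))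
  obtain ⟨v, hv, hvη, hvy⟩ := y.exists_isTwoSidedOrbit (n := 0)
    (hη.isPast_right (hu.isPast_pastAt 0)) hη0
  exact ⟨u, v, ⟨hu, hv, by simpa using hvη.symm ▸ hη⟩, hux, fun i => hvy i (Nat.zero_le i)⟩

theorem exists_linkedAt_of_dist_le (hsurj : Function.Surjective π)
    (hρ : HasIsometricSheets π ρ) (hφ : IsBackwardContracting c φ) (hr0 : 0 < r) (hr : 2 * r < ρ)
    {N : ℕ} (hN : 1 ≤ N) {x y : LimitSpace π φ} {n : ℕ} (h : ∀ i ≤ n, dist (x.1 i) (y.1 i) ≤ r) :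
    ∃ u v, LinkedAt π φ r N n u v ∧ (∀ i : ℕ, u i = x.1 i) ∧ ∀ i : ℕ, v i = y.1 i := by
  obtain ⟨u, hu, hux⟩ := exists_extension hsurj x
  obtain ⟨η, hη0, hη⟩ := (hu.isPast_pastAt n).exists_step hρ hφ (show r < ρ by linarith)
    (z := y.1 n) (by rw [pastAt_zero, hux]; exact h n le_rfl)
  obtain ⟨v, hv, hvη, hvy⟩ := y.exists_isTwoSidedOrbit (n := n) hη.right hη0
  refine ⟨u, v, ⟨hu, hv, ?_⟩, hux, fun i => ?_⟩
  · rw [hvη]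
    exact (Steps.single hη).mono (hη.right.step_self hr0.le) hN
  · rcases le_or_gt n i with hi | hi
    · exact hvy i hi
    · refine Nat.decreasingInduction (motive := fun j _ => v j = y.1 j) (fun j hj ih => ?_)
        (hvy n le_rfl) hi.le
      have h1 : dist (x.1 j) (v j) ≤ r := by
        have := hη.dist_le ((n : ℤ) - j).toNat
        rwa [← hvη, pastAt_toNat u (by omega), pastAt_toNat v (by omega), hux] at this
      have h2 := h j hj.le
      have h3 := hρ.isometric (v j) (y.1 j) (by linarith [dist_triangle_left (v j) (y.1 j) (x.1 j)])
      have h4 : v ((j : ℤ) + 1) = y.1 (j + 1) := by exact_mod_cast ih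
      rw [hv j, y.2 j, h4, dist_self] at h3
      exact dist_eq_zero.1 h3.symm

/-- Every point of the limit space has preimages under iterates of the shift close to a given
point. -/
theorem exists_shift_iterate_eq (hsurj : Function.Surjective π)
    (hρ : HasIsometricSheets π ρ) (hφ : IsBackwardContracting c φ) (hr : r < ρ) {N : ℕ}
    (hN : ∀ x y : X₁, Steps (fun a b => dist a b ≤ r) N x y) (x z : LimitSpace π φ) (n : ℕ) :
    ∃ y, (shift π φ)^[n] y = z ∧ y ∈ cylinder (N * r) c n x := by
  obtain ⟨u, hu, hux⟩ := exists_extension hsurj x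
  obtain ⟨η, hη0, hη⟩ := (hu.isPast_pastAt n).exists_steps hρ hφ hr (hN _ (z.1 0))
  obtain ⟨v, hv, hvη, hvz⟩ := z.exists_isTwoSidedOrbit (n := 0)
    (hη.isPast_right (hu.isPast_pastAt n)) hη0
  have hy : IsTwoSidedOrbit π φ fun i => v (i - n) := fun i => by
    have := hv (i - n)
    rwa [show i - (n : ℤ) + 1 = i + 1 - n by ring] at this
  refine ⟨hy.toLimitSpace, ext_coord fun i => ?_, fun i hi => ?_⟩
  · rw [shift_iterate_coord, ← hvz i (Nat.zero_le i)]
    change v (((i + n : ℕ) : ℤ) - n) = v i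
    push_cast
    rw [add_sub_cancel_right]
  · have h1 := hη.dist_past_le hρ hφ hr (n - i)
    change dist (x.1 i) (v (i - n)) ≤ _
    rw [← hvη] at h1
    simp only [pastAt] at h1
    rwa [show (n : ℤ) - ((n - i : ℕ) : ℤ) = i by omega, hux,
      show ((0 : ℕ) : ℤ) - ((n - i : ℕ) : ℤ) = i - n by omega] at h1

end Connected

end LimitSpace

theorem IsCoveringMapOfDegree.surjective {X Y : Type*} [TopologicalSpace X] [TopologicalSpace Y]
    [Nonempty X] {p : X → Y} {d : ℕ} (hp : IsCoveringMapOfDegree p d) : Function.Surjective p := by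
  intro y
  have hd : (d : ℕ∞) ≠ 0 := by
    rw [← hp.2 (p (Classical.arbitrary X)), Ne, encard_eq_zero]
    exact Set.Nonempty.ne_empty ⟨Classical.arbitrary X, rfl⟩
  rw [← hp.2 y, Ne, encard_eq_zero, ← Ne, ← nonempty_iff_ne_empty] at hd
  exact hd

/-! ### The shift: covering, expansiveness and the cxc axioms -/

namespace LimitSpace

variable {X₀ X₁ : Type*} {π φ : X₁ → X₀}

/-- Prepend a term to a point of the limit space. -/
def cons (b : X₁) (z : LimitSpace π φ) (h : π b = φ (z.1 0)) : LimitSpace π φ :=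
  ⟨consSeq b z.1, fun i => by
    cases i with
    | zero => exact h
    | succ i => exact z.2 i⟩

theorem shift_cons (b : X₁) (z : LimitSpace π φ) (h : π b = φ (z.1 0)) :
    shift π φ (cons b z h) = z := rfl

theorem eq_of_shift_eq {x y : LimitSpace π φ} (h0 : x.1 0 = y.1 0)
    (h : shift π φ x = shift π φ y) : x = y :=
  ext_coord fun i => by
    cases i with
    | zero => exact h0
    | succ i => exact congrArg (fun z : LimitSpace π φ => z.1 i) h

theorem encard_shift_fiber (z : LimitSpace π φ) :
    (shift π φ ⁻¹' {z}).encard = (π ⁻¹' {φ (z.1 0)}).encard := by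
  have hinj : InjOn (fun x : LimitSpace π φ => x.1 0) (shift π φ ⁻¹' {z}) :=
    fun x hx y hy h0 => eq_of_shift_eq h0 ((mem_singleton_iff.1 hx).trans hy.symm)
  rw [← hinj.encard_image]
  congr 1
  ext b
  constructor
  · rintro ⟨x, rfl, rfl⟩
    exact x.2 0
  · intro hb
    exact ⟨cons b z hb, shift_cons b z hb, rfl⟩

section MetricSource

variable [MetricSpace X₁]

theorem continuous_shift (π φ : X₁ → X₀) : Continuous (shift π φ) :=
  continuous_induced_rng.2 (continuous_pi fun i => continuous_coord (i + 1))

end MetricSource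

variable [MetricSpace X₀] [MetricSpace X₁] {c ρ r : ℝ}

/-- A point near `shift π φ x` gets a first term near that of `x` by lifting isometrically, and the
remaining coordinates are already close. -/
theorem isOpenMap_shift [CompactSpace (LimitSpace π φ)] (hρ : HasIsometricSheets π ρ)
    (hφ : IsBackwardContracting c φ) : IsOpenMap (shift π φ) := by
  refine IsOpenMap.of_nhds_le fun x U hU => ?_
  obtain ⟨n, δ, hδ, hsub⟩ := exists_coords_subset (mem_map.1 hU)
  refine mem_of_superset (mem_nhds_of_coords (shift π φ x) n (lt_min hδ hρ.pos)) fun z hz => ?_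
  have h1 : dist (π (x.1 0)) (φ (z.1 0)) < min δ ρ := by
    rw [x.2 0]
    calc _ ≤ c * dist (x.1 1) (z.1 0) := hφ.2.2 _ _
      _ ≤ 1 * dist (x.1 1) (z.1 0) := by gcongr; exact hφ.2.1.le
      _ < min δ ρ := (one_mul _).trans_lt (hz 0 (Nat.zero_le _))
  obtain ⟨b, hb, hbd⟩ := hρ.exists_lift _ _ (h1.trans_le (min_le_right _ _))
  refine hsub (show cons b z hb ∈ _ from fun i hi => ?_)
  cases i with
  | zero => exact hbd.trans_lt (h1.trans_le (min_le_left _ _))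
  | succ i => exact (hz i (by omega)).trans_le (min_le_left _ _)

theorem isCoveringMap_shift [CompactSpace (LimitSpace π φ)] (hρ : HasIsometricSheets π ρ)
    (hφ : IsBackwardContracting c φ) : IsCoveringMap (shift π φ) := by
  have := metrizableSpace π φ
  rw [← isLocalHomeomorph_iff_isCoveringMap, isLocalHomeomorph_iff_isOpenEmbedding_restrict]
  intro x
  have hU : IsOpen {y : LimitSpace π φ | dist (x.1 0) (y.1 0) < ρ / 2} :=
    isOpen_lt (continuous_const.dist (continuous_coord 0)) continuous_const
  refine ⟨_, hU.mem_nhds (by simpa using hρ.pos), ?_⟩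
  refine .of_continuous_injective_isOpenMap ((continuous_shift π φ).comp continuous_subtype_val)
    ?_ ((isOpenMap_shift hρ hφ).comp hU.isOpenMap_subtype_val)
  rintro ⟨y, hy⟩ ⟨z, hz⟩ hyz
  have hyz' : shift π φ y = shift π φ z := hyz
  rw [mem_ofPred_eq] at hy hz
  refine Subtype.ext (eq_of_shift_eq ?_ hyz')
  have h1 := hρ.isometric (y.1 0) (z.1 0) (by linarith [dist_triangle_left (y.1 0) (z.1 0) (x.1 0)])
  have h2 : y.1 1 = z.1 1 := congrArg (fun w : LimitSpace π φ => w.1 0) hyz'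
  rw [y.2 0, z.2 0, h2, dist_self] at h1
  exact dist_eq_zero.1 h1.symm

/-- Each distance is at most `c` times the one at the next index; with all of them bounded by `ρ`,
iterating forces them to vanish. -/
theorem eq_of_forall_dist_lt (hρ : HasIsometricSheets π ρ) (hφ : IsBackwardContracting c φ)
    {x y : LimitSpace π φ} (h : ∀ i, dist (x.1 i) (y.1 i) < ρ) : x = y := by
  have key : ∀ k i, dist (x.1 i) (y.1 i) ≤ c ^ k * ρ := by
    intro k
    induction k with
    | zero => intro i; simpa using (h i).le
    | succ k ih =>
      intro i
      rw [← hρ.isometric _ _ (h i), x.2 i, y.2 i]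
      calc _ ≤ c * dist (x.1 (i + 1)) (y.1 (i + 1)) := hφ.2.2 _ _
        _ ≤ c * (c ^ k * ρ) := mul_le_mul_of_nonneg_left (ih _) hφ.1.le
        _ = _ := by ring
  refine ext_coord fun i => dist_le_zero.1 ?_
  have hlim := (tendsto_pow_atTop_nhds_zero_of_lt_one hφ.1.le hφ.2.1).mul_const ρ
  rw [zero_mul] at hlim
  exact ge_of_tendsto' hlim fun k => key k i

theorem separatesOrbits_shift [CompactSpace (LimitSpace π φ)] (hρ : HasIsometricSheets π ρ)
    (hφ : IsBackwardContracting c φ) {m : MetricSpace (LimitSpace π φ)}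
    (hm : IsCompatibleMetric m) : SeparatesOrbits m (shift π φ) := by
  obtain ⟨e, he, h⟩ := hm.exists_pos_forall_dist_lt (continuous_coord (π := π) (φ := φ) 0) hρ.pos
  refine ⟨e, he, fun x y hxy => ?_⟩
  by_contra! hle
  refine hxy (eq_of_forall_dist_lt hρ hφ fun i => ?_)
  have := h _ _ (hle i)
  simpa only [shift_iterate_coord, Nat.zero_add] using this

/-- The members of the iterated pullbacks of a cover by small sets are small. -/
theorem dist_le_of_mem_iteratedPullback (hρ : HasIsometricSheets π ρ)
    (hφ : IsBackwardContracting c φ) (hr0 : 0 < r) (hr : r < ρ) {𝒰 : Set (Set (LimitSpace π φ))}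
    (h𝒰 : ∀ U ∈ 𝒰, ∀ w ∈ U, ∀ w' ∈ U, dist (w.1 0) (w'.1 0) ≤ r) (n : ℕ) :
    ∀ U ∈ iteratedPullback (shift π φ) 𝒰 n, ∀ w ∈ U, ∀ w' ∈ U, ∀ i ≤ n,
      dist (w.1 i) (w'.1 i) ≤ r * c ^ (n - i) := by
  have hc := hφ.1
  induction n with
  | zero =>
    intro U hU w hw w' hw' i hi
    obtain rfl : i = 0 := by omega
    simpa using h𝒰 U hU w hw w' hw'
  | succ n ih =>
    intro V hV w hw w' hw'
    rw [iteratedPullback, Function.iterate_succ_apply'] at hV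
    obtain ⟨U, hU, x, -, rfl⟩ := hV
    have hmap : ∀ v ∈ connectedComponentIn (shift π φ ⁻¹' U) x, shift π φ v ∈ U :=
      fun v hv => connectedComponentIn_subset (shift π φ ⁻¹' U) x hv
    have hs : ∀ v ∈ connectedComponentIn (shift π φ ⁻¹' U) x, ∀ i ≤ n,
        dist (w.1 (i + 1)) (v.1 (i + 1)) ≤ r * c ^ (n - i) := fun v hv i hi =>
      ih U hU _ (hmap w hw) _ (hmap v hv) i hi
    intro i hi
    cases i with
    | succ i => simpa using hs w' hw' i (by omega)
    | zero =>
      have hlt : r * c ^ (n + 1) < ρ :=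
        (mul_le_of_le_one_right hr0.le (pow_le_one₀ hc.le hφ.2.1.le)).trans_lt hr
      -- The new first coordinate cannot jump to another sheet: its distances avoid `(r * c ^ (n +
      -- 1), ρ)`, and the component is connected.
      refine isPreconnected_connectedComponentIn.forall_le_of_gap
        (g := fun v : LimitSpace π φ => dist (w.1 0) (v.1 0))
        (continuous_const.dist (continuous_coord 0)).continuousOn hlt ?_ hw
        (by rw [dist_self]; positivity) w' hw'
      intro v hv hvρ
      rw [← hρ.isometric _ _ hvρ, w.2 0, v.2 0]
      calc _ ≤ c * dist (w.1 1) (v.1 1) := hφ.2.2 _ _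
        _ ≤ c * (r * c ^ n) := mul_le_mul_of_nonneg_left (hs v hv 0 (Nat.zero_le _)) hc.le
        _ = _ := by ring

theorem axiomExpansion_shift [CompactSpace (LimitSpace π φ)] (hρ : HasIsometricSheets π ρ)
    (hφ : IsBackwardContracting c φ) (hr0 : 0 < r) (hr : r < ρ) {𝒰 : Set (Set (LimitSpace π φ))}
    (h𝒰 : ∀ U ∈ 𝒰, ∀ w ∈ U, ∀ w' ∈ U, dist (w.1 0) (w'.1 0) ≤ r) :
    AxiomExpansion (shift π φ) 𝒰 := by
  refine ⟨metrizableSpace π φ, fun m hm => ENNReal.tendsto_nhds_zero.2 fun ε hε => ?_⟩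
  obtain ⟨δ, hδ, hδε⟩ := ENNReal.lt_iff_exists_nnreal_btwn.1 hε
  have hδ' : (0 : ℝ) < δ := by exact_mod_cast hδ
  obtain ⟨n₀, η, hη, hclose⟩ := hm.exists_forall_dist_lt
    (g := fun i (x : LimitSpace π φ) => x.1 i) continuous_coord (fun x y => ext_coord) hδ'
  have hlim := (tendsto_pow_atTop_nhds_zero_of_lt_one hφ.1.le hφ.2.1).const_mul r
  rw [mul_zero] at hlim
  obtain ⟨k, hk⟩ := (hlim.eventually_lt_const hη).exists
  filter_upwards [eventually_ge_atTop (n₀ + k)] with n hn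
  refine iSup₂_le fun U hU => Metric.ediam_le fun w hw w' hw' => ?_
  rw [edist_dist]
  refine le_trans ?_ hδε.le
  rw [← ENNReal.ofReal_coe_nnreal]
  refine ENNReal.ofReal_le_ofReal (hclose w w' fun i hi => ?_).le
  refine (dist_le_of_mem_iteratedPullback hρ hφ hr0 hr h𝒰 n U hU w hw w' hw' i
    (by omega)).trans_lt (lt_of_le_of_lt ?_ hk)
  exact mul_le_mul_of_nonneg_left (pow_le_pow_of_le_one hφ.1.le hφ.2.1.le (by omega)) hr0.le

/-- The iterates are injective on pulled-back sets: two points of a fiber in `V` are `ρ`-close up to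
index `n + k` because `V` is small, and agree from index `k` on. -/
theorem axiomDegree_shift (hρ : HasIsometricSheets π ρ)
    (hφ : IsBackwardContracting c φ) (hr0 : 0 < r) (hr : r < ρ) {𝒰 : Set (Set (LimitSpace π φ))}
    (h𝒰 : ∀ U ∈ 𝒰, ∀ w ∈ U, ∀ w' ∈ U, dist (w.1 0) (w'.1 0) ≤ r) :
    AxiomDegree (shift π φ) 𝒰 := by
  refine ⟨1, fun n k U _ V hV _ y _ => ?_⟩
  rw [Nat.cast_one, encard_le_one_iff]
  rintro w w' ⟨hw, hwy⟩ ⟨hw', hwy'⟩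
  refine eq_of_forall_dist_lt hρ hφ fun i => ?_
  rcases le_or_gt i (n + k) with hi | hi
  · refine (dist_le_of_mem_iteratedPullback hρ hφ hr0 hr h𝒰 _ V hV w hw w' hw' i hi).trans_lt
      ((mul_le_of_le_one_right hr0.le (pow_le_one₀ hφ.1.le hφ.2.1.le)).trans_lt hr)
  · have h1 : (shift π φ)^[k] w = (shift π φ)^[k] w' :=
      (mem_singleton_iff.1 hwy).trans (mem_singleton_iff.1 hwy').symm
    have h2 := congrArg (fun z : LimitSpace π φ => z.1 (i - k)) h1
    simp only [shift_iterate_coord, show i - k + k = i by omega] at h2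
    rw [h2, dist_self]
    exact hρ.pos

/-- Cylinders shrink to points. -/
theorem exists_cylinder_subset [CompactSpace (LimitSpace π φ)] (hφ : IsBackwardContracting c φ)
    {B : ℝ} (hB : 0 ≤ B) {x : LimitSpace π φ} {U : Set (LimitSpace π φ)} (hU : U ∈ 𝓝 x) :
    ∃ n, cylinder B c n x ⊆ U := by
  obtain ⟨n₀, δ, hδ, hsub⟩ := exists_coords_subset hU
  have hlim := (tendsto_pow_atTop_nhds_zero_of_lt_one hφ.1.le hφ.2.1).const_mul B
  rw [mul_zero] at hlim
  obtain ⟨k, hk⟩ := (hlim.eventually_lt_const hδ).exists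
  refine ⟨n₀ + k, fun y hy => hsub fun i hi => (hy i (by omega)).trans_lt (lt_of_le_of_lt ?_ hk)⟩
  exact mul_le_mul_of_nonneg_left (pow_le_pow_of_le_one hφ.1.le hφ.2.1.le (by omega)) hB

theorem axiomIrreducibility_shift [CompactSpace (LimitSpace π φ)] (hsurj : Function.Surjective π)
    (hρ : HasIsometricSheets π ρ) (hφ : IsBackwardContracting c φ) (hr0 : 0 < r) (hr : r < ρ)
    {N : ℕ} (hN : ∀ x y : X₁, Steps (fun a b => dist a b ≤ r) N x y) :
    AxiomIrreducibility (shift π φ) := by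
  rintro W hW ⟨x, hx⟩
  obtain ⟨n, hn⟩ := exists_cylinder_subset hφ (B := N * r) (by positivity) (hW.mem_nhds hx)
  refine ⟨n, eq_univ_of_forall fun z => ?_⟩
  obtain ⟨y, hy, hyx⟩ := exists_shift_iterate_eq hsurj hρ hφ hr hN x z n
  exact ⟨y, hn hyx, hy⟩

end LimitSpace

/-! ### Choice of constants and conclusion -/

/-- The limit space of a recurrent contracting virtual endomorphism is connected and locally
connected. -/
theorem LimitSpace.connectedSpace_and_locallyConnectedSpace {X₀ X₁ : Type*} [MetricSpace X₀]
    [MetricSpace X₁] [CompactSpace X₁] [PathConnectedSpace X₁] (hX₁ : IsLengthMetric X₁)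
    {π φ : C(X₁, X₀)} (hπ : IsCoveringMap π) (hsurj : Function.Surjective π) {ρ c : ℝ}
    (hρ : HasIsometricSheets π ρ) (hφ : IsBackwardContracting c φ) (hrec : IsRecurrent φ) :
    ConnectedSpace (LimitSpace π φ) ∧ LocallyConnectedSpace (LimitSpace π φ) := by
  have hcomp : CompactSpace (LimitSpace π φ) := compactSpace π.continuous φ.continuous
  have hne : Nonempty (LimitSpace π φ) := nonempty π.continuous φ.continuous hsurj
  have hρ0 := hρ.pos
  obtain ⟨hc0, hc1, -⟩ := id hφ
  obtain ⟨r, hr⟩ : ∃ r, r = ρ / 4 := ⟨_, rfl⟩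
  have hr0 : 0 < r := by linarith
  obtain ⟨N', hN'⟩ := exists_forall_steps_dist (X := X₁) hr0
  obtain ⟨N, hN⟩ : ∃ N, N = N' + 1 + N' := ⟨_, rfl⟩
  obtain ⟨M, hM⟩ := hrec.exists_forall_steps_consSeq hπ hρ hφ hX₁ hr0 (by linarith) N
  have hNr : 0 ≤ (N : ℝ) * r := by positivity
  have hMN : 0 ≤ ((M + 1 : ℕ) : ℝ) * (N * r) := by positivity
  -- The sum of the geometric series of displacements, chosen so that `N * r ≤ B` and `((M + 1) * (N
  -- * r) + B) * c ≤ B`.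
  obtain ⟨B, hB⟩ : ∃ B, B = (((M + 1 : ℕ) : ℝ) * (N * r) + N * r) / (1 - c) := ⟨_, rfl⟩
  have hB' : B * (1 - c) = ((M + 1 : ℕ) : ℝ) * (N * r) + N * r := by
    rw [hB, div_mul_cancel₀ _ (by linarith)]
  have hB0 : 0 ≤ B := by
    rw [hB]
    exact div_nonneg (by linarith) (by linarith)
  have hchain := exists_chain_linkedAt hρ hφ hr0 (by linarith) (N := N) (M := M + 1)
    (fun n u v h => exists_steps_linkedAt_succ hρ hφ hr0 (by linarith) hN' hN.ge hM h)
    (B := B) (by nlinarith) (by nlinarith)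
  have hself : ∀ x : X₁, dist x x ≤ r := fun x => by simpa using hr0.le
  constructor
  · refine { toPreconnectedSpace := ⟨?_⟩, toNonempty := hne }
    refine isPreconnected_of_forall_pair fun x _ y _ => ?_
    obtain ⟨u, v, h, hu, hv⟩ := exists_linkedAt_zero hsurj hρ hφ (show r < ρ by linarith)
      (N := N) (fun x y => (hN' x y).mono (hself y) (by omega)) x y
    have hy := mem_connectedComponentIn_cylinder hρ hφ (by linarith) hB0 hchain (n := 0)
      h hu hv
    exact ⟨_, subset_univ _, mem_connectedComponentIn
      (connectedComponentIn_nonempty_iff.1 ⟨y, hy⟩), hy, isPreconnected_connectedComponentIn⟩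
  · refine locallyConnectedSpace_iff_connected_subsets.2 fun x U hU => ?_
    obtain ⟨n, hn⟩ := exists_cylinder_subset hφ hB0 hU
    refine ⟨connectedComponentIn (cylinder B c n x) x, ?_, isPreconnected_connectedComponentIn,
      (connectedComponentIn_subset _ _).trans hn⟩
    refine mem_of_superset (mem_nhds_of_coords x n hr0) fun y hy => ?_
    obtain ⟨u, v, h, hu, hv⟩ := exists_linkedAt_of_dist_le hsurj hρ hφ hr0 (by linarith)
      (show 1 ≤ N by omega) (fun i hi => (hy i hi).le)
    exact mem_connectedComponentIn_cylinder hρ hφ (by linarith) hB0 hchain h hu hv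

/-- A compact locally connected limit space has a finite cover by connected open sets on which the
first coordinate varies little. -/
theorem LimitSpace.exists_finite_cover {X₀ X₁ : Type*} [MetricSpace X₁] {π φ : X₁ → X₀}
    [CompactSpace (LimitSpace π φ)] [LocallyConnectedSpace (LimitSpace π φ)] {r : ℝ} (hr : 0 < r) :
    ∃ 𝒰 : Set (Set (LimitSpace π φ)), 𝒰.Finite ∧ (∀ U ∈ 𝒰, IsOpen U ∧ IsConnected U) ∧
      ⋃₀ 𝒰 = univ ∧ ∀ U ∈ 𝒰, ∀ w ∈ U, ∀ w' ∈ U, dist (w.1 0) (w'.1 0) ≤ r := by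
  have hex : ∀ x : LimitSpace π φ, ∃ U : Set (LimitSpace π φ), x ∈ U ∧ IsOpen U ∧ IsConnected U ∧
      ∀ w ∈ U, ∀ w' ∈ U, dist (w.1 0) (w'.1 0) ≤ r := by
    intro x
    obtain ⟨U, hU, hUo, hxU, hUc⟩ := locallyConnectedSpace_iff_subsets_isOpen_isConnected.1
      inferInstance x _ (mem_nhds_of_coords x 0 (half_pos hr))
    refine ⟨U, hxU, hUo, hUc, fun w hw w' hw' => ?_⟩
    have h1 := hU hw 0 le_rfl
    have h2 := hU hw' 0 le_rfl
    linarith [dist_triangle_left (w.1 0) (w'.1 0) (x.1 0)]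
  choose U hxU hUo hUc hUd using hex
  obtain ⟨t, ht⟩ := isCompact_univ.elim_finite_subcover U hUo
    fun x _ => mem_iUnion.2 ⟨x, hxU x⟩
  refine ⟨U '' t, t.finite_toSet.image U, ?_, eq_univ_of_forall fun x => ?_, ?_⟩
  · rintro _ ⟨x, -, rfl⟩
    exact ⟨hUo x, hUc x⟩
  · obtain ⟨y, hy, hxy⟩ := mem_iUnion₂.1 (ht (mem_univ x))
    exact ⟨U y, ⟨y, hy, rfl⟩, hxy⟩
  · rintro _ ⟨x, -, rfl⟩
    exact hUd x

theorem theorem2p1 {X₀ X₁ : Type*} [MetricSpace X₀] [MetricSpace X₁]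
    [CompleteSpace X₀] [CompleteSpace X₁]
    [CWComplex (univ : Set X₀)] [CWComplex.Finite (univ : Set X₀)]
    [CWComplex (univ : Set X₁)] [CWComplex.Finite (univ : Set X₁)]
    (hX₀ : IsLengthMetric X₀) (hX₁ : IsLengthMetric X₁)
    (π φ : C(X₁, X₀)) (d : ℕ) (hπ : IsCoveringMapOfDegree π d)
    (hloc : IsLocalIsometry π)
    (c : ℝ) (hφ : IsBackwardContracting c φ) (hrec : IsRecurrent φ) :
    (ConnectedSpace (LimitSpace π φ) ∧ LocallyConnectedSpace (LimitSpace π φ)) ∧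
    (IsPositivelyExpansive (LimitSpace.shift π φ) ∧
      IsCoveringMapOfDegree (LimitSpace.shift π φ) d) ∧
    IsTopologicallyCXC (LimitSpace.shift π φ) := by
  have : CompactSpace X₁ := compactSpace_of_finite_cwComplex
  have : ConnectedSpace X₁ := hrec.connected_source
  have : PathConnectedSpace X₁ :=
    ⟨inferInstance, fun x y => ⟨(hX₁.exists_path (lt_add_one (dist x y))).choose⟩⟩
  have hsurj := hπ.surjective
  obtain ⟨ρ, hρ⟩ := hloc.exists_hasIsometricSheets π.continuous hπ.1.isOpenMap
  have hρ0 := hρ.pos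
  have hcomp : CompactSpace (LimitSpace π φ) :=
    LimitSpace.compactSpace π.continuous φ.continuous
  obtain ⟨hconn, hlc⟩ := LimitSpace.connectedSpace_and_locallyConnectedSpace hX₁ hπ.1 hsurj hρ hφ
    hrec
  have hcov : IsCoveringMapOfDegree (LimitSpace.shift π φ) d :=
    ⟨LimitSpace.isCoveringMap_shift hρ hφ, fun z => by
      rw [LimitSpace.encard_shift_fiber, hπ.2]⟩
  refine ⟨⟨hconn, hlc⟩, ⟨⟨LimitSpace.metrizableSpace π φ, LimitSpace.continuous_shift π φ,
    hcov.surjective, fun m hm => LimitSpace.separatesOrbits_shift hρ hφ hm⟩, hcov⟩,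
    hcomp, hconn, hlc, hcov.1, ?_⟩
  have hr0 : 0 < ρ / 2 := half_pos hρ0
  have hr : ρ / 2 < ρ := half_lt_self hρ0
  obtain ⟨N, hN⟩ := exists_forall_steps_dist (X := X₁) hr0
  obtain ⟨𝒰, hfin, hoc, hcover, hsmall⟩ := LimitSpace.exists_finite_cover (π := π) (φ := φ) hr0
  exact ⟨𝒰, hfin, hoc, hcover, LimitSpace.axiomExpansion_shift hρ hφ hr0 hr hsmall,
    LimitSpace.axiomDegree_shift hρ hφ hr0 hr hsmall,
    LimitSpace.axiomIrreducibility_shift hsurj hρ hφ hr0 hr hN⟩
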